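/- **Setting.** Let $\mathcal X=\mathbb R^d$, let $k:\mathcal X\times\mathcal X\to\mathbb R$ be a symmetric positive semidefinite kernel with reproducing kernel Hilbert space $\mathcal H$, let $x_1,\dots,x_n\in\mathcal X$ be fixed points and $y_i=f_*(x_i)+\epsilon_i$, where $f_*:\mathcal X\to\mathbb R$ is a fixed function and $\epsilon_1,\dots,\epsilon_n$ are i.i.d. with law $\rho$ of mean zero and (finite) variance $\sigma^2$. For fixed $f$ put $\mathcal E(f)=\mathbb E\,\frac1n\sum_{i=1}^n(f(x_i)-y_i)^2$ and let $R(f)=\mathcal E(f)-\inf_{v\in\mathcal H}\mathcal E(v)$ be its excess risk. Let $K=(k(x_i,x_j))_{i,j}\in\mathbb R^{n\times n}$, assume $K\neq0$, let $\|K\|$ be its spectral norm, and for $\lambda>0$ let $\tilde d(\lambda)=n\max_i\big(K(K+\lambda nI)^{-1}\big)_{ii}$. *KRLS.* $\bar f_\lambda(x)=\sum_{i=1}^n\bar\alpha_i\,k(x,x_i)$ with $\bar\alpha=(K+\lambda nI)^{-1}y$. *NYTRO.* For a subset $M=\{\tilde x_1,\dots,\tilde x_m\}$ of $m$ of the $n$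 training points (selected by index) let $(K_{nm})_{ij}=k(x_i,\tilde x_j)$ and $(K_{mm})_{ij}=k(\tilde x_i,\tilde x_j)$, and let $R_M\in\mathbb R^{m\times\operatorname{rank}K_{mm}}$ be any matrix with $R_MR_M^\top=K_{mm}^\dagger$ (Moore–Penrose pseudoinverse). With $\hat\beta_0=0$ and $\hat\beta_{s}=\hat\beta_{s-1}-\frac{\gamma}{n}R_M^\top K_{nm}^\top(K_{nm}R_M\hat\beta_{s-1}-y)$, put $\hat f_{m,\gamma,t}(x)=\sum_{i=1}^m(R_M\hat\beta_t)_i\,k(\tilde x_i,x)$. **Corollary.** Let $t\ge2$ be an integer, $\gamma=1/\|K\|$, $\delta\in(0,1)$, and let $m\le n$ satisfy $$m\ \ge\ \Big(\frac{32\,\tilde d(1/(\gamma t))}{\delta}+2\Big)\log\frac{n\|K\|\gamma t}{\delta}.$$ If $M$ is drawn uniformly at random among the subsets of $m$ training points, independently of the noise, then $$\mathbb E_M\,\mathbb E\,R\big(\hat f_{m,\gamma,t}\big)\ \le\ c_{t,\delta}\ \mathbb E\,R\big(\bar f_{1/(\gamma t)}\big),\qquad c_{t,\delta}=4\Big(1+\frac1{t-1}\Big)^2(1+4\delta)\le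 80,$$ where $\mathbb E$ is the expectation over the noise in $y$ (and all these expectations are finite). -/

import Mathlib

open MeasureTheory ProbabilityTheory Finset
open scoped BigOperators

noncomputable section

namespace Nytro

variable {𝓧 Ω : Type*} {n : ℕ}

/-! ### Fixed-design learning problem -/

/-- The outputs `y_i = f_*(x_i) + ε_i`, as a function of the noise realization `ω`. -/
def output (fstar : 𝓧 → ℝ) (x : Fin n → 𝓧) (ε : Fin n → Ω → ℝ) (ω : Ω) : Fin n → ℝ :=
  fun i => fstar (x i) + ε i ω

/-- The expected risk `𝓔(f) = E (1/n) ∑_i (f(x_i) - y_i)²` of a fixed function `f`, for random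
outputs `y` on the probability space `(Ω, P)`. -/
def expectedRisk [MeasurableSpace Ω] (P : Measure Ω) (x : Fin n → 𝓧) (y : Ω → Fin n → ℝ)
    (f : 𝓧 → ℝ) : ℝ :=
  ∫ ω, (1 / (n : ℝ)) * ∑ i, (f (x i) - y ω i) ^ 2 ∂P

/-- The excess risk `R(f) = 𝓔(f) - inf_{v ∈ H} 𝓔(v)`, where the hypothesis space `H` is a
reproducing kernel Hilbert space of real functions on `𝓧`. -/
def excessRisk (H : Type*) [NormedAddCommGroup H] [InnerProductSpace ℝ H] [RKHS ℝ H 𝓧 ℝ]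
    [MeasurableSpace Ω] (P : Measure Ω) (x : Fin n → 𝓧) (y : Ω → Fin n → ℝ) (f : 𝓧 → ℝ) : ℝ :=
  expectedRisk P x y f - ⨅ v : H, expectedRisk P x y (⇑v)

/-- `k` is the (scalar) reproducing kernel of the reproducing kernel Hilbert space `H`. In
particular `k` is symmetric and positive semidefinite, and every symmetric positive semidefinite
`k` is the kernel of such an `H`. -/
def IsKernelOf (k : 𝓧 → 𝓧 → ℝ) (H : Type*) [NormedAddCommGroup H] [InnerProductSpace ℝ H]
    [CompleteSpace H] [RKHS ℝ H 𝓧 ℝ] : Prop :=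
  ∀ x x' : 𝓧, RKHS.kernel H x x' 1 = k x x'

/-! ### Kernel matrices -/

/-- The empirical kernel matrix `K`, `K_{ij} = k(x_i, x_j)`. -/
def gram (k : 𝓧 → 𝓧 → ℝ) (x : Fin n → 𝓧) : Matrix (Fin n) (Fin n) ℝ :=
  Matrix.of fun i j => k (x i) (x j)

/-- The matrix `K_{nm}` of the kernel between all points and the points selected by `M`. -/
def gramNM (k : 𝓧 → 𝓧 → ℝ) (x : Fin n → 𝓧) (M : Finset (Fin n)) : Matrix (Fin n) M ℝ :=
  Matrix.of fun i j => k (x i) (x j)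

/-- The matrix `K_{mm}` of the kernel between the points selected by `M`. -/
def gramMM (k : 𝓧 → 𝓧 → ℝ) (x : Fin n → 𝓧) (M : Finset (Fin n)) : Matrix M M ℝ :=
  Matrix.of fun i j => k (x i) (x j)

/-- The spectral norm (Euclidean operator norm) of a square real matrix. -/
def specNorm (A : Matrix (Fin n) (Fin n) ℝ) : ℝ :=
  ‖Matrix.toEuclideanCLM (n := Fin n) (𝕜 := ℝ) A‖

/-- `X` is the Moore–Penrose pseudoinverse of the real matrix `A`. -/
structure IsPseudoinverse {ι κ : Type*} [Fintype ι] [Fintype κ]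
    (A : Matrix ι κ ℝ) (X : Matrix κ ι ℝ) : Prop where
  mul_mul_left : A * X * A = A
  mul_mul_right : X * A * X = X
  symm_left : (A * X).transpose = A * X
  symm_right : (X * A).transpose = X * A

/-- `d̃(λ) = n max_i (K (K + λ n I)⁻¹)_{ii}`. -/
def dTilde (K : Matrix (Fin n) (Fin n) ℝ) (lam : ℝ) : ℝ :=
  (n : ℝ) * ⨆ i : Fin n, (K * (K + (lam * n) • (1 : Matrix (Fin n) (Fin n) ℝ))⁻¹) i i

/-! ### The two estimators -/

/-- The kernel regularized least squares (KRLS) solution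
`f̄_λ(u) = ∑_i ᾱ_i k(u, x_i)`, `ᾱ = (K + λ n I)⁻¹ y`, for the output vector `y`. -/
def krls (k : 𝓧 → 𝓧 → ℝ) (x : Fin n → 𝓧) (lam : ℝ) (y : Fin n → ℝ) : 𝓧 → ℝ :=
  fun u => ∑ i,
    ((gram k x + (lam * n) • (1 : Matrix (Fin n) (Fin n) ℝ))⁻¹).mulVec y i * k u (x i)

/-- The NYTRO iterates: `β_0 = 0`,
`β_{t+1} = β_t - (γ/n) Rᵀ (K_{nm}ᵀ (K_{nm} R β_t - y))`. -/
def nytroIter (k : 𝓧 → 𝓧 → ℝ) (x : Fin n → 𝓧) (M : Finset (Fin n)) {r : ℕ}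
    (R : Matrix M (Fin r) ℝ) (γ : ℝ) (y : Fin n → ℝ) : ℕ → Fin r → ℝ
  | 0 => 0
  | t + 1 =>
    nytroIter k x M R γ y t - (γ / n) • R.transpose.mulVec
      ((gramNM k x M).transpose.mulVec
        ((gramNM k x M).mulVec (R.mulVec (nytroIter k x M R γ y t)) - y))

/-- The NYTRO solution after `t` iterations: `f̂(u) = ∑_{i ∈ M} α̂_i k(x_i, u)`, `α̂ = R β_t`. -/
def nytro (k : 𝓧 → 𝓧 → ℝ) (x : Fin n → 𝓧) (M : Finset (Fin n)) {r : ℕ}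
    (R : Matrix M (Fin r) ℝ) (γ : ℝ) (t : ℕ) (y : Fin n → ℝ) : 𝓧 → ℝ :=
  fun u => ∑ i : M, R.mulVec (nytroIter k x M R γ y t) i * k (x i) u

end Nytro

end

/-!
# NYTRO is as accurate as kernel regularized least squares

Write `K = gram k x`, `c = lam * n = n ‖K‖ / t` and, for a subset `M`, let `L` be the Nyström
approximation of `K` on `M`. The fitted values of both estimators are linear in the outputs: KRLS
has the matrix `S = K (K + c)⁻¹`, and `t` gradient steps on the subset have the matrix
`1 - (1 - B)^t` with `B = L / (t c)`. In a reproducing kernel Hilbert space, the excess risk is the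
squared distance to the projection `v` of the target values onto the range of `K`
(`excessRisk_eq`), so the expected risks split into squared bias and variance
(`integral_excessRisk_linear`).

*Variance.* For `0 ≤ u ≤ 1` the filter `1 - (1 - u)^t` is at most `2 t u / (1 + t u)`, and
`A ↦ A (A + c)⁻¹` is monotone in the Loewner order. Since `L ≤ K`, the variance of NYTRO is at
most four times that of KRLS for every `M` (`landweber_variance_le`).

*Bias.* Let `q = c (K + c)⁻¹ v` be the bias of KRLS. If `‖K - L‖ ≤ c`, then
`v = (1 + t B + (K - L) / c) q` and `(1 - u)^t (1 + t u) ≤ 1` give `‖(1 - B)^t v‖ ≤ 2 ‖q‖`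
(`landweber_bias_le`). For arbitrary `M` there is the crude bound
`‖(1 - B)^t v‖ ≤ ‖v‖ ≤ (1 + t / n) ‖q‖`. This settles `t ≤ n`; for `t ≥ n` it remains to show that
`‖K - L‖ ≤ c` fails only with tiny probability.

*Concentration.* With `ψ i` the rows of `S^(1/2)`, the condition `‖K - L‖ ≤ c` follows once no
nonzero `u` orthogonal to the selected `ψ i` satisfies `uᵀ S u > ‖u‖² / 2`
(`nystrom_residual_norm_le`). This is a lower tail event for a sum of random rank-one matrices
with `n ‖ψ i‖² ≤ dTilde K lam`. It is bounded by the matrix Laplace transform method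
(`card_bad_sequences_le`), which rests on the Golden–Thompson inequality (`trace_exp_add_le`),
itself a consequence of trace inequalities for powers `2^k` and of the Lie product formula.
That bound concerns sampling with replacement; since enlarging `M` only helps, sampling without
replacement fails at most as often (`card_bad_subsets_mul_le`).
-/

namespace Nytro

open Matrix

/-! ### Trace inequalities for matrix powers -/

section TracePowers

variable {ι : Type*} [Fintype ι]

lemma trace_mul_transpose_self_nonneg (A : Matrix ι ι ℝ) : 0 ≤ (A * Aᵀ).trace := by
  simp only [Matrix.trace, Matrix.diag, Matrix.mul_apply, Matrix.transpose_apply]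
  exact Finset.sum_nonneg fun i _ => Finset.sum_nonneg fun j _ => mul_self_nonneg _

lemma trace_mul_le_half_add {P R : Matrix ι ι ℝ} (hP : Pᵀ = P) (hR : Rᵀ = R) :
    (P * R).trace ≤ ((P * P).trace + (R * R).trace) / 2 := by
  have h := trace_mul_transpose_self_nonneg (P - R)
  rw [transpose_sub, hP, hR, sub_mul, mul_sub, mul_sub, trace_sub, trace_sub, trace_sub,
    trace_mul_comm R P] at h
  linarith

/-- Expand `0 ≤ tr (W - Wᵀ)(W - Wᵀ)ᵀ`. -/
lemma trace_mul_self_le (W : Matrix ι ι ℝ) : (W * W).trace ≤ (W * Wᵀ).trace := by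
  have h := trace_mul_transpose_self_nonneg (W - Wᵀ)
  rw [transpose_sub, transpose_transpose, sub_mul, mul_sub, mul_sub, trace_sub, trace_sub,
    trace_sub, trace_mul_comm Wᵀ W] at h
  have h2 : (Wᵀ * Wᵀ).trace = (W * W).trace := by
    rw [← transpose_mul, trace_transpose]
  linarith

variable [DecidableEq ι]

lemma trace_mul_pow_comm (A B : Matrix ι ι ℝ) (k : ℕ) :
    ((A * B) ^ k).trace = ((B * A) ^ k).trace := by
  cases k with
  | zero => simp
  | succ k =>
    have h : ∀ k : ℕ, (A * B) ^ (k + 1) = A * ((B * A) ^ k * B) := by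
      intro k
      induction k with
      | zero => simp
      | succ k ih => rw [pow_succ', ih, pow_succ']; simp only [mul_assoc]
    rw [h, trace_mul_comm, mul_assoc, ← pow_succ]

/-- The two inequalities `tr (XY)^(2^k) ≤ tr X^(2^k) Y^(2^k)` for symmetric `X`, `Y`, and
`tr W^(2^(k+1)) ≤ tr (W Wᵀ)^(2^k)` for arbitrary `W`, feed each other along `k`: the second is
applied to `W = XY`, and the first to `WᵀW` and `WWᵀ`, which have the same power traces. -/
lemma trace_pow_two_pow_aux (k : ℕ) :
    (∀ X Y : Matrix ι ι ℝ, Xᵀ = X → Yᵀ = Y →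
      ((X * Y) ^ 2 ^ k).trace ≤ (X ^ 2 ^ k * Y ^ 2 ^ k).trace) ∧
    ∀ W : Matrix ι ι ℝ, (W ^ 2 ^ (k + 1)).trace ≤ ((W * Wᵀ) ^ 2 ^ k).trace := by
  induction k with
  | zero =>
    refine ⟨fun X Y _ _ => by simp, fun W => ?_⟩
    simpa [pow_two] using trace_mul_self_le W
  | succ k ih =>
    obtain ⟨ih1, ih2⟩ := ih
    constructor
    · intro X Y hX hY
      have e : (X * Y) * (X * Y)ᵀ = X * (Y * Y * X) := by
        rw [transpose_mul, hX, hY]; simp only [mul_assoc]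
      calc ((X * Y) ^ 2 ^ (k + 1)).trace ≤ (((X * Y) * (X * Y)ᵀ) ^ 2 ^ k).trace := ih2 _
        _ = (((Y * Y) * (X * X)) ^ 2 ^ k).trace := by
          rw [e, trace_mul_pow_comm]; simp only [mul_assoc]
        _ ≤ ((Y * Y) ^ 2 ^ k * (X * X) ^ 2 ^ k).trace :=
          ih1 _ _ (by rw [transpose_mul, hY]) (by rw [transpose_mul, hX])
        _ = (X ^ 2 ^ (k + 1) * Y ^ 2 ^ (k + 1)).trace := by
          rw [trace_mul_comm, ← pow_two, ← pow_two, ← pow_mul, ← pow_mul, ← pow_succ']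
    · intro W
      have hR : ∀ j : ℕ, (((W * Wᵀ) ^ j)ᵀ) = (W * Wᵀ) ^ j := fun j => by
        rw [transpose_pow, transpose_mul, transpose_transpose]
      have hP : ∀ j : ℕ, (((Wᵀ * W) ^ j)ᵀ) = (Wᵀ * W) ^ j := fun j => by
        rw [transpose_pow, transpose_mul, transpose_transpose]
      have e : (W * W) * (W * W)ᵀ = W * (W * Wᵀ * Wᵀ) := by
        rw [transpose_mul]; simp only [mul_assoc]
      calc (W ^ 2 ^ (k + 1 + 1)).trace = ((W * W) ^ 2 ^ (k + 1)).trace := by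
            rw [pow_succ' 2 (k + 1), pow_mul, pow_two]
        _ ≤ (((W * W) * (W * W)ᵀ) ^ 2 ^ k).trace := ih2 _
        _ = (((W * Wᵀ) * (Wᵀ * W)) ^ 2 ^ k).trace := by
          rw [e, trace_mul_pow_comm]; simp only [mul_assoc]
        _ ≤ ((W * Wᵀ) ^ 2 ^ k * (Wᵀ * W) ^ 2 ^ k).trace :=
          ih1 _ _ (by simp) (by simp)
        _ ≤ (((W * Wᵀ) ^ 2 ^ k * (W * Wᵀ) ^ 2 ^ k).trace
            + ((Wᵀ * W) ^ 2 ^ k * (Wᵀ * W) ^ 2 ^ k).trace) / 2 :=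
          trace_mul_le_half_add (hR _) (hP _)
        _ = ((W * Wᵀ) ^ 2 ^ (k + 1)).trace := by
          rw [← pow_add, ← pow_add, trace_mul_pow_comm Wᵀ W, pow_succ, mul_two]; ring

end TracePowers

/-! ### The Lie product formula -/

section LieProduct

variable {𝔸 : Type*} [NormedRing 𝔸] [NormOneClass 𝔸]

lemma norm_pow_sub_pow_le {C : ℝ} (hC : 1 ≤ C) {X Y : 𝔸} (hX : ‖X‖ ≤ C) (hY : ‖Y‖ ≤ C) (N : ℕ) :
    ‖X ^ N - Y ^ N‖ ≤ N * C ^ N * ‖X - Y‖ := by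
  induction N with
  | zero => simp
  | succ N ih =>
    have e : X ^ (N + 1) - Y ^ (N + 1) = X * (X ^ N - Y ^ N) + (X - Y) * Y ^ N := by
      rw [pow_succ', pow_succ']; noncomm_ring
    have h1 : ‖X * (X ^ N - Y ^ N)‖ ≤ C * (N * C ^ N * ‖X - Y‖) :=
      (norm_mul_le _ _).trans (mul_le_mul hX ih (norm_nonneg _) (by linarith))
    have h2 : ‖(X - Y) * Y ^ N‖ ≤ ‖X - Y‖ * C ^ N :=
      (norm_mul_le _ _).trans (mul_le_mul_of_nonneg_left
        ((norm_pow_le Y N).trans (pow_le_pow_left₀ (norm_nonneg _) hY N)) (norm_nonneg _))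
    have h3 : C ^ N ≤ C ^ (N + 1) := pow_le_pow_right₀ hC (Nat.le_succ N)
    calc _ ≤ ‖X * (X ^ N - Y ^ N)‖ + ‖(X - Y) * Y ^ N‖ := by rw [e]; exact norm_add_le _ _
      _ ≤ C * (N * C ^ N * ‖X - Y‖) + ‖X - Y‖ * C ^ (N + 1) :=
        add_le_add h1 (h2.trans (mul_le_mul_of_nonneg_left h3 (norm_nonneg _)))
      _ = _ := by push_cast; ring

variable [NormedAlgebra ℝ 𝔸]

lemma norm_exp_le_exp_norm (a : 𝔸) : ‖NormedSpace.exp a‖ ≤ Real.exp ‖a‖ := by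
  let _ : NormedAlgebra ℚ 𝔸 := NormedAlgebra.restrictScalars ℚ ℝ 𝔸
  rw [NormedSpace.exp_eq_tsum ℝ, Real.exp_eq_exp_ℝ, NormedSpace.exp_eq_tsum ℝ]
  refine tsum_of_norm_bounded (NormedSpace.expSeries_summable' (𝕂 := ℝ) ‖a‖).hasSum fun k => ?_
  rw [norm_smul, norm_inv, Real.norm_natCast, smul_eq_mul]
  gcongr
  exact norm_pow_le a k

variable [CompleteSpace 𝔸]

/-- The **Lie product formula**: `(exp (a/N) exp (b/N))^N → exp (a + b)`. -/
lemma tendsto_lie_product (a b : 𝔸) :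
    Filter.Tendsto (fun N : ℕ => (NormedSpace.exp ((N : ℝ)⁻¹ • a) *
      NormedSpace.exp ((N : ℝ)⁻¹ • b)) ^ N) Filter.atTop (nhds (NormedSpace.exp (a + b))) := by
  let _ : NormedAlgebra ℚ 𝔸 := NormedAlgebra.restrictScalars ℚ ℝ 𝔸
  have hd : HasDerivAt (fun s : ℝ => NormedSpace.exp (s • a) * NormedSpace.exp (s • b)
      - NormedSpace.exp (s • (a + b))) 0 0 := by
    have ha := hasDerivAt_exp_smul_const (𝕂 := ℝ) a (0 : ℝ)
    have hb := hasDerivAt_exp_smul_const (𝕂 := ℝ) b (0 : ℝ)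
    have hab := hasDerivAt_exp_smul_const (𝕂 := ℝ) (a + b) (0 : ℝ)
    exact ((ha.mul hb).sub hab).congr_deriv (by simp)
  -- the discrepancy of one factor is `o(1/N)`
  have hlim : Filter.Tendsto (fun N : ℕ => (N : ℝ) * ‖NormedSpace.exp ((N : ℝ)⁻¹ • a) *
      NormedSpace.exp ((N : ℝ)⁻¹ • b) - NormedSpace.exp ((N : ℝ)⁻¹ • (a + b))‖)
      Filter.atTop (nhds 0) := by
    have h0 := hasDerivAt_iff_tendsto.mp hd
    have hN : Filter.Tendsto (fun N : ℕ => ((N : ℝ))⁻¹) Filter.atTop (nhds 0) :=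
      tendsto_inv_atTop_nhds_zero_nat
    have := h0.comp hN
    refine this.congr fun N => ?_
    simp [NormedSpace.exp_zero]
  rw [tendsto_iff_norm_sub_tendsto_zero]
  have hlim2 := hlim.const_mul (Real.exp (‖a‖ + ‖b‖))
  rw [mul_zero] at hlim2
  refine squeeze_zero' (Filter.Eventually.of_forall fun _ => norm_nonneg _) ?_ hlim2
  filter_upwards [Filter.eventually_gt_atTop 0] with N hN
  have hN' : (N : ℝ) ≠ 0 := by positivity
  have hpow : NormedSpace.exp ((N : ℝ)⁻¹ • (a + b)) ^ N = NormedSpace.exp (a + b) := by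
    rw [← NormedSpace.exp_nsmul, ← Nat.cast_smul_eq_nsmul ℝ, smul_smul, mul_inv_cancel₀ hN',
      one_smul]
  have hnorm : ∀ z : 𝔸, ‖(N : ℝ)⁻¹ • z‖ = (N : ℝ)⁻¹ * ‖z‖ := fun z => by
    rw [norm_smul, norm_inv, Real.norm_natCast]
  have hX : ‖NormedSpace.exp ((N : ℝ)⁻¹ • a) * NormedSpace.exp ((N : ℝ)⁻¹ • b)‖ ≤
      Real.exp ((N : ℝ)⁻¹ * (‖a‖ + ‖b‖)) := by
    refine (norm_mul_le _ _).trans ?_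
    rw [mul_add, Real.exp_add, ← hnorm, ← hnorm]
    exact mul_le_mul (norm_exp_le_exp_norm _) (norm_exp_le_exp_norm _) (norm_nonneg _)
      (Real.exp_pos _).le
  have hY : ‖NormedSpace.exp ((N : ℝ)⁻¹ • (a + b))‖ ≤ Real.exp ((N : ℝ)⁻¹ * (‖a‖ + ‖b‖)) := by
    refine (norm_exp_le_exp_norm _).trans (Real.exp_le_exp.mpr ?_)
    rw [hnorm]
    gcongr
    exact norm_add_le _ _
  have := norm_pow_sub_pow_le (Real.one_le_exp (by positivity)) hX hY N
  rw [hpow, ← Real.exp_nat_mul, ← mul_assoc, mul_inv_cancel₀ hN', one_mul] at this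
  linarith

end LieProduct

/-! ### The Golden–Thompson inequality -/

section GoldenThompson

variable {ι : Type*} [Fintype ι] [DecidableEq ι]

open scoped Matrix.Norms.L2Operator in
/-- The **Golden–Thompson inequality** for real symmetric matrices. -/
lemma trace_exp_add_le {A B : Matrix ι ι ℝ} (hA : Aᵀ = A) (hB : Bᵀ = B) :
    (NormedSpace.exp (A + B)).trace ≤ (NormedSpace.exp A * NormedSpace.exp B).trace := by
  cases isEmpty_or_nonempty ι with
  | inl h => simp [Matrix.trace]
  | inr h =>
  let _ : NormedAlgebra ℚ (Matrix ι ι ℝ) := NormedAlgebra.restrictScalars ℚ ℝ _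
  have h1 := (tendsto_lie_product A B).comp (tendsto_pow_atTop_atTop_of_one_lt one_lt_two)
  have h2 := ((continuous_id.matrix_trace (n := ι) (R := ℝ)).tendsto _).comp h1
  refine le_of_tendsto h2 (Filter.Eventually.of_forall fun k => ?_)
  have hs : ∀ Z : Matrix ι ι ℝ, Zᵀ = Z → ∀ s : ℝ,
      (NormedSpace.exp (s • Z))ᵀ = NormedSpace.exp (s • Z) := fun Z hZ s => by
    rw [← Matrix.exp_transpose, transpose_smul, hZ]
  have hp : ∀ Z : Matrix ι ι ℝ,
      NormedSpace.exp ((((2 ^ k : ℕ) : ℝ))⁻¹ • Z) ^ 2 ^ k = NormedSpace.exp Z := fun Z => by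
    rw [← NormedSpace.exp_nsmul, ← Nat.cast_smul_eq_nsmul ℝ, smul_smul,
      mul_inv_cancel₀ (by positivity), one_smul]
  have := (trace_pow_two_pow_aux k).1 _ _ (hs A hA (((2 ^ k : ℕ) : ℝ))⁻¹)
    (hs B hB (((2 ^ k : ℕ) : ℝ))⁻¹)
  rw [hp, hp] at this
  exact this

end GoldenThompson

/-! ### Real positive semidefinite matrices -/

section PosSemidef

variable {ι : Type*}

lemma isSymm_of_posSemidef {A : Matrix ι ι ℝ} (h : A.PosSemidef) : Aᵀ = A := by
  have := h.isHermitian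
  rwa [Matrix.IsHermitian, conjTranspose_eq_transpose_of_trivial] at this

variable [Fintype ι]

lemma posSemidef_of_form_nonneg {A : Matrix ι ι ℝ} (hA : Aᵀ = A)
    (h : ∀ u, 0 ≤ u ⬝ᵥ A *ᵥ u) : A.PosSemidef :=
  .of_dotProduct_mulVec_nonneg
    (by rw [Matrix.IsHermitian, conjTranspose_eq_transpose_of_trivial, hA])
    fun u => by rw [star_trivial]; exact h u

lemma form_nonneg_of_posSemidef {A : Matrix ι ι ℝ} (h : A.PosSemidef) (u : ι → ℝ) :
    0 ≤ u ⬝ᵥ A *ᵥ u := by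
  simpa using h.dotProduct_mulVec_nonneg u

end PosSemidef

/-! ### Functions of a diagonalized symmetric matrix -/

section Spectral

variable {ι : Type*} [Fintype ι] [DecidableEq ι]

/-- The symmetric matrix with eigenvalues `f` in the basis formed by the columns of `U`. For a
fixed orthogonal `U` this is the functional calculus of a diagonalized matrix. -/
def spectralMatrix (U : Matrix ι ι ℝ) (f : ι → ℝ) : Matrix ι ι ℝ := U * diagonal f * Uᵀ

lemma exists_eq_spectralMatrix {H : Matrix ι ι ℝ} (hH : Hᵀ = H) :
    ∃ (U : Matrix ι ι ℝ) (f : ι → ℝ), Uᵀ * U = 1 ∧ U * Uᵀ = 1 ∧ H = spectralMatrix U f := by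
  have hH' : H.IsHermitian := by
    rw [Matrix.IsHermitian, conjTranspose_eq_transpose_of_trivial, hH]
  have hs : ∀ A : Matrix ι ι ℝ, star A = Aᵀ := fun A => by
    rw [star_eq_conjTranspose, conjTranspose_eq_transpose_of_trivial]
  refine ⟨hH'.eigenvectorUnitary, hH'.eigenvalues, ?_, ?_, ?_⟩
  · rw [← hs]; exact Unitary.coe_star_mul_self _
  · rw [← hs]; exact Unitary.coe_mul_star_self _
  · have := hH'.spectral_theorem
    rw [Unitary.conjStarAlgAut_apply, hs] at this
    exact this

variable {U : Matrix ι ι ℝ}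

lemma spectralMatrix_transpose (f : ι → ℝ) : (spectralMatrix U f)ᵀ = spectralMatrix U f := by
  simp [spectralMatrix, transpose_mul, mul_assoc]

lemma spectralMatrix_mul (hU : Uᵀ * U = 1) (f g : ι → ℝ) :
    spectralMatrix U f * spectralMatrix U g = spectralMatrix U (fun i => f i * g i) := by
  rw [spectralMatrix, spectralMatrix, spectralMatrix, ← diagonal_mul_diagonal]
  calc U * diagonal f * Uᵀ * (U * diagonal g * Uᵀ)
      = U * diagonal f * (Uᵀ * U) * diagonal g * Uᵀ := by simp only [mul_assoc]
    _ = _ := by rw [hU, mul_one]; simp only [mul_assoc]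

lemma spectralMatrix_one (hU' : U * Uᵀ = 1) : spectralMatrix U (fun _ => 1) = 1 := by
  simp [spectralMatrix, hU']

lemma spectralMatrix_add (f g : ι → ℝ) :
    spectralMatrix U f + spectralMatrix U g = spectralMatrix U (fun i => f i + g i) := by
  rw [spectralMatrix, spectralMatrix, spectralMatrix, ← diagonal_add, mul_add, add_mul]

lemma spectralMatrix_sub (f g : ι → ℝ) :
    spectralMatrix U f - spectralMatrix U g = spectralMatrix U (fun i => f i - g i) := by
  rw [spectralMatrix, spectralMatrix, spectralMatrix, ← diagonal_sub, mul_sub, sub_mul]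

lemma spectralMatrix_smul (a : ℝ) (f : ι → ℝ) :
    a • spectralMatrix U f = spectralMatrix U (fun i => a * f i) := by
  have : diagonal (fun i => a * f i) = a • diagonal f := by
    rw [← diagonal_smul]; rfl
  rw [spectralMatrix, spectralMatrix, this, Matrix.mul_smul, Matrix.smul_mul]

lemma spectralMatrix_pow (hU : Uᵀ * U = 1) (hU' : U * Uᵀ = 1) (f : ι → ℝ) (k : ℕ) :
    spectralMatrix U f ^ k = spectralMatrix U (fun i => f i ^ k) := by
  induction k with
  | zero => simp [spectralMatrix_one hU']
  | succ k ih => simp only [pow_succ, ih, spectralMatrix_mul hU]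

lemma exp_spectralMatrix (hU : Uᵀ * U = 1) (hU' : U * Uᵀ = 1) (f : ι → ℝ) :
    NormedSpace.exp (spectralMatrix U f) = spectralMatrix U (fun i => Real.exp (f i)) := by
  have h := Matrix.exp_units_conj ⟨U, Uᵀ, hU', hU⟩ (diagonal f)
  rw [exp_diagonal] at h
  have e : NormedSpace.exp f = fun i => Real.exp (f i) := by
    ext i; rw [Pi.coe_exp, Real.exp_eq_exp_ℝ]
  rw [e] at h
  exact h

lemma trace_spectralMatrix (hU : Uᵀ * U = 1) (f : ι → ℝ) :
    (spectralMatrix U f).trace = ∑ i, f i := by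
  rw [spectralMatrix, trace_mul_comm, ← mul_assoc, hU, one_mul, trace_diagonal]

lemma dotProduct_mulVec_spectralMatrix (f : ι → ℝ) (u : ι → ℝ) :
    u ⬝ᵥ spectralMatrix U f *ᵥ u = ∑ i, f i * (Uᵀ *ᵥ u) i ^ 2 := by
  rw [spectralMatrix, ← mulVec_mulVec, ← mulVec_mulVec, dotProduct_mulVec, ← mulVec_transpose,
    dotProduct]
  refine Finset.sum_congr rfl fun i _ => ?_
  rw [mulVec_diagonal]; ring

lemma dotProduct_self_eq_sum (hU' : U * Uᵀ = 1) (u : ι → ℝ) :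
    u ⬝ᵥ u = ∑ i, (Uᵀ *ᵥ u) i ^ 2 := by
  have := dotProduct_mulVec_spectralMatrix (U := U) (fun _ => 1) u
  simpa [spectralMatrix_one hU'] using this

lemma spectralMatrix_col (hU : Uᵀ * U = 1) (f : ι → ℝ) (i : ι) :
    spectralMatrix U f *ᵥ (U *ᵥ Pi.single i 1) = f i • (U *ᵥ Pi.single i 1) := by
  rw [spectralMatrix, mulVec_mulVec, mul_assoc, hU, mul_one, ← mulVec_mulVec, ← mulVec_smul]
  congr 1
  ext j
  rw [mulVec_diagonal, Pi.smul_apply, smul_eq_mul]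
  by_cases h : j = i
  · subst h; simp
  · simp [h]

lemma dotProduct_col_self (hU : Uᵀ * U = 1) (i : ι) :
    (U *ᵥ Pi.single i 1) ⬝ᵥ (U *ᵥ Pi.single i 1) = (1 : ℝ) := by
  rw [dotProduct_mulVec, ← mulVec_transpose, mulVec_mulVec, hU]; simp

lemma spectralMatrix_posSemidef {f : ι → ℝ} (hf : ∀ i, 0 ≤ f i) :
    (spectralMatrix U f).PosSemidef := by
  refine .of_dotProduct_mulVec_nonneg ?_ fun u => ?_
  · rw [Matrix.IsHermitian, conjTranspose_eq_transpose_of_trivial, spectralMatrix_transpose]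
  · rw [star_trivial, dotProduct_mulVec_spectralMatrix]
    exact Finset.sum_nonneg fun i _ => mul_nonneg (hf i) (sq_nonneg _)

/-- A matrix whose quadratic form is at most `a` times the square norm has eigenvalues `≤ a`. -/
lemma eigenvalue_le_of_form_le (hU : Uᵀ * U = 1) {f : ι → ℝ} {a : ℝ}
    (h : ∀ u, u ⬝ᵥ spectralMatrix U f *ᵥ u ≤ a * (u ⬝ᵥ u)) (i : ι) : f i ≤ a := by
  have := h (U *ᵥ Pi.single i 1)
  rwa [spectralMatrix_col hU, dotProduct_smul, dotProduct_col_self hU, smul_eq_mul, mul_one,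
    mul_one] at this

lemma eigenvalue_nonneg_of_form_nonneg (hU : Uᵀ * U = 1) {f : ι → ℝ}
    (h : ∀ u, 0 ≤ u ⬝ᵥ spectralMatrix U f *ᵥ u) (i : ι) : 0 ≤ f i := by
  have := h (U *ᵥ Pi.single i 1)
  rwa [spectralMatrix_col hU, dotProduct_smul, dotProduct_col_self hU, smul_eq_mul, mul_one]
    at this

/-- The square norm of `T u`, for `T` a spectral matrix with eigenvalues in `[-a, a]`. -/
lemma spectralMatrix_mulVec_norm_le (hU : Uᵀ * U = 1) (hU' : U * Uᵀ = 1) {f : ι → ℝ} {a : ℝ}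
    (h : ∀ i, |f i| ≤ a) (u : ι → ℝ) :
    (spectralMatrix U f *ᵥ u) ⬝ᵥ (spectralMatrix U f *ᵥ u) ≤ a ^ 2 * (u ⬝ᵥ u) := by
  rw [dotProduct_mulVec, ← mulVec_transpose, spectralMatrix_transpose, mulVec_mulVec,
    spectralMatrix_mul hU, dotProduct_comm, dotProduct_mulVec_spectralMatrix,
    dotProduct_self_eq_sum hU', Finset.mul_sum]
  refine Finset.sum_le_sum fun i _ => mul_le_mul_of_nonneg_right ?_ (sq_nonneg _)
  rw [← pow_two, ← sq_abs]
  exact pow_le_pow_left₀ (abs_nonneg _) (h i) 2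

lemma trace_mul_nonneg_of_posSemidef {A B : Matrix ι ι ℝ} (hA : A.PosSemidef)
    (hB : B.PosSemidef) : 0 ≤ (A * B).trace := by
  obtain ⟨U, f, hU, -, rfl⟩ := exists_eq_spectralMatrix (isSymm_of_posSemidef hA)
  have hf := eigenvalue_nonneg_of_form_nonneg hU (form_nonneg_of_posSemidef hA)
  rw [spectralMatrix, mul_assoc, trace_mul_comm, ← mul_assoc, trace_mul_comm]
  simp only [Matrix.trace, diag_apply, diagonal_mul]
  refine Finset.sum_nonneg fun i _ => mul_nonneg (hf i) ?_
  have := (hB.conjTranspose_mul_mul_same U).diag_nonneg (i := i)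
  rwa [conjTranspose_eq_transpose_of_trivial] at this

lemma exp_posSemidef {H : Matrix ι ι ℝ} (hH : Hᵀ = H) : (NormedSpace.exp H).PosSemidef := by
  obtain ⟨U, f, hU, hU', rfl⟩ := exists_eq_spectralMatrix hH
  rw [exp_spectralMatrix hU hU']
  exact spectralMatrix_posSemidef fun i => (Real.exp_pos _).le

lemma exp_le_one_add_add_sq {x : ℝ} (hx : x ≤ 1) : Real.exp x ≤ 1 + x + x ^ 2 := by
  by_cases h : -1 ≤ x
  · have := abs_le.mp (Real.abs_exp_sub_one_sub_id_le (abs_le.mpr ⟨h, hx⟩))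
    linarith [this.2]
  · have : Real.exp x ≤ 1 := Real.exp_le_one_iff.mpr (by linarith)
    nlinarith

lemma one_add_add_sq_sub_exp_posSemidef {H : Matrix ι ι ℝ} (hH : Hᵀ = H)
    (h : ∀ u, u ⬝ᵥ H *ᵥ u ≤ u ⬝ᵥ u) : (1 + H + H * H - NormedSpace.exp H).PosSemidef := by
  obtain ⟨U, f, hU, hU', rfl⟩ := exists_eq_spectralMatrix hH
  have hf := eigenvalue_le_of_form_le hU (a := 1) (by simpa using h)
  rw [exp_spectralMatrix hU hU', spectralMatrix_mul hU, ← spectralMatrix_one hU',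
    spectralMatrix_add, spectralMatrix_add, spectralMatrix_sub]
  refine spectralMatrix_posSemidef fun i => ?_
  have := exp_le_one_add_add_sq (hf i)
  nlinarith

/-- The trace of `exp H` dominates the exponential of every Rayleigh quotient of `H`. -/
lemma exp_le_trace_exp {H : Matrix ι ι ℝ} (hH : Hᵀ = H) {a : ℝ} {u : ι → ℝ} (hu : 0 < u ⬝ᵥ u)
    (h : a * (u ⬝ᵥ u) ≤ u ⬝ᵥ H *ᵥ u) : Real.exp a ≤ (NormedSpace.exp H).trace := by
  obtain ⟨U, f, hU, hU', rfl⟩ := exists_eq_spectralMatrix hH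
  rw [exp_spectralMatrix hU hU', trace_spectralMatrix hU]
  obtain ⟨i, hi⟩ : ∃ i, a ≤ f i := by
    by_contra! hcon
    rw [dotProduct_mulVec_spectralMatrix, dotProduct_self_eq_sum hU', Finset.mul_sum] at h
    rw [dotProduct_self_eq_sum hU'] at hu
    obtain ⟨i, hi, hpos⟩ :=
      Finset.exists_lt_of_sum_lt (f := fun _ : ι => (0 : ℝ)) (by simpa using hu)
    refine absurd h (not_le.mpr (Finset.sum_lt_sum (fun j _ => ?_) ⟨i, hi, ?_⟩))
    · exact mul_le_mul_of_nonneg_right (hcon j).le (sq_nonneg _)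
    · exact mul_lt_mul_of_pos_right (hcon i) hpos
  exact (Real.exp_le_exp.mpr hi).trans
    (Finset.single_le_sum (f := fun i => Real.exp (f i)) (fun i _ => (Real.exp_pos _).le)
      (Finset.mem_univ i))

end Spectral

/-! ### Lower tails of sums of random rank-one matrices -/

section RandomSums

variable {ι κ : Type*} [Fintype κ]

lemma centred_isSymm (ψ : κ → ι → ℝ) (S : Matrix ι ι ℝ) (hS : ∑ i, vecMulVec (ψ i) (ψ i) = S)
    (θ N : ℝ) (i : κ) :
    (θ • (S - N • vecMulVec (ψ i) (ψ i)))ᵀ = θ • (S - N • vecMulVec (ψ i) (ψ i)) := by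
  have hSsym : Sᵀ = S := by
    rw [← hS, transpose_sum]; exact Finset.sum_congr rfl fun i _ => transpose_vecMulVec _ _
  rw [transpose_smul, transpose_sub, transpose_smul, hSsym, transpose_vecMulVec]

variable [Fintype ι]

lemma dotProduct_vecMulVec_self_mulVec (ψ u : ι → ℝ) :
    u ⬝ᵥ vecMulVec ψ ψ *ᵥ u = (ψ ⬝ᵥ u) ^ 2 := by
  rw [vecMulVec_mulVec, dotProduct_smul, dotProduct_comm u ψ]
  simp [pow_two]

/-- The second moment of the centred rank-one increments `S - N ψ ψᵀ`. -/
lemma sum_centred_sq (N : ℝ) (hN : N = Fintype.card κ) (Z : κ → Matrix ι ι ℝ) (q : κ → ℝ)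
    (hZZ : ∀ i, Z i * Z i = q i • Z i) (S : Matrix ι ι ℝ) (hS : ∑ i, Z i = S) :
    ∑ i, (S - N • Z i) * (S - N • Z i) = N ^ 2 • ∑ i, q i • Z i - N • (S * S) := by
  have e : ∀ i, (S - N • Z i) * (S - N • Z i) =
      S * S - N • (S * Z i) - N • (Z i * S) + N ^ 2 • (q i • Z i) := by
    intro i
    rw [← hZZ, sub_mul, mul_sub, mul_sub, Matrix.smul_mul, Matrix.mul_smul, Matrix.smul_mul,
      Matrix.mul_smul, smul_smul, pow_two]
    abel
  have h1 : ∑ i, N • (S * Z i) = N • (S * S) := by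
    rw [← Finset.smul_sum, ← Finset.mul_sum, hS]
  have h2 : ∑ i, N • (Z i * S) = N • (S * S) := by
    rw [← Finset.smul_sum, ← Finset.sum_mul, hS]
  have h3 : ∑ _i : κ, S * S = N • (S * S) := by
    rw [Finset.sum_const, Finset.card_univ, ← Nat.cast_smul_eq_nsmul ℝ, ← hN]
  rw [Finset.sum_congr rfl fun i _ => e i, Finset.sum_add_distrib, Finset.sum_sub_distrib,
    Finset.sum_sub_distrib, h1, h2, h3, ← Finset.smul_sum]
  abel

/-- The form of the increments `θ (S - N ψ ψᵀ)`. -/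
lemma form_centred (S : Matrix ι ι ℝ) (ψ u : ι → ℝ) (θ N : ℝ) :
    u ⬝ᵥ (θ • (S - N • vecMulVec ψ ψ)) *ᵥ u = θ * (u ⬝ᵥ S *ᵥ u - N * (ψ ⬝ᵥ u) ^ 2) := by
  rw [smul_mulVec, sub_mulVec, smul_mulVec, dotProduct_smul, dotProduct_sub, dotProduct_smul,
    dotProduct_vecMulVec_self_mulVec, smul_eq_mul, smul_eq_mul]

lemma form_sum_vecMulVec (ψ : κ → ι → ℝ) (u : ι → ℝ) :
    u ⬝ᵥ (∑ i, vecMulVec (ψ i) (ψ i)) *ᵥ u = ∑ i, (ψ i ⬝ᵥ u) ^ 2 := by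
  rw [sum_mulVec, dotProduct_sum]
  exact Finset.sum_congr rfl fun i _ => dotProduct_vecMulVec_self_mulVec _ _

variable [DecidableEq ι]

/-- Iterated Golden–Thompson: if the exponentials of the increments sum to at most `a`, then
summing `tr exp` over all sequences of `m` increments gives at most `a ^ m` times the dimension. -/
lemma sum_trace_exp_sum_le (X : κ → Matrix ι ι ℝ) (hX : ∀ i, (X i)ᵀ = X i) {a : ℝ} (ha0 : 0 ≤ a)
    (ha : (a • (1 : Matrix ι ι ℝ) - ∑ i, NormedSpace.exp (X i)).PosSemidef) (m : ℕ) :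
    ∑ s : Fin m → κ, (NormedSpace.exp (∑ j, X (s j))).trace ≤ a ^ m * Fintype.card ι := by
  induction m with
  | zero => simp [Matrix.trace]
  | succ m ih =>
    have hsym : ∀ s : Fin m → κ, (∑ j, X (s j))ᵀ = ∑ j, X (s j) := fun s => by
      rw [transpose_sum]; simp only [hX]
    calc ∑ s : Fin (m + 1) → κ, (NormedSpace.exp (∑ j, X (s j))).trace
        = ∑ s : Fin m → κ, ∑ i : κ, (NormedSpace.exp (∑ j, X (s j) + X i)).trace := by
          rw [← (Fin.consEquiv fun _ : Fin (m + 1) => κ).sum_comp, Fintype.sum_prod_type_right]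
          refine Finset.sum_congr rfl fun s _ => Finset.sum_congr rfl fun i _ => ?_
          rw [Fin.sum_univ_succ, add_comm]
          simp [Fin.consEquiv]
      _ ≤ ∑ s : Fin m → κ, a * (NormedSpace.exp (∑ j, X (s j))).trace := by
          refine Finset.sum_le_sum fun s _ => ?_
          have h1 : ∀ i, (NormedSpace.exp (∑ j, X (s j) + X i)).trace ≤
              (NormedSpace.exp (∑ j, X (s j)) * NormedSpace.exp (X i)).trace :=
            fun i => trace_exp_add_le (hsym s) (hX i)
          have h2 := trace_mul_nonneg_of_posSemidef (exp_posSemidef (hsym s)) ha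
          rw [mul_sub, trace_sub, Matrix.mul_smul, mul_one, trace_smul, Matrix.mul_sum, trace_sum,
            smul_eq_mul] at h2
          exact (Finset.sum_le_sum fun i _ => h1 i).trans (by linarith)
      _ ≤ a ^ (m + 1) * Fintype.card ι := by
          rw [← Finset.mul_sum, pow_succ', mul_assoc]
          exact mul_le_mul_of_nonneg_left ih ha0

/-- The exponentials of the centred increments `θ (S - N ψ ψᵀ)` have mean at most `1 + θ² d`. -/
lemma sum_exp_centred_le (ψ : κ → ι → ℝ) (S : Matrix ι ι ℝ)
    (hS : ∑ i, vecMulVec (ψ i) (ψ i) = S) (hS1 : ∀ u, u ⬝ᵥ S *ᵥ u ≤ u ⬝ᵥ u)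
    {N : ℝ} (hN : N = Fintype.card κ)
    {d : ℝ} (hd0 : 0 ≤ d) (hd : ∀ i, N * (ψ i ⬝ᵥ ψ i) ≤ d)
    {θ : ℝ} (hθ0 : 0 ≤ θ) (hθ1 : θ ≤ 1) :
    ((N * (1 + θ ^ 2 * d)) • (1 : Matrix ι ι ℝ)
      - ∑ i, NormedSpace.exp (θ • (S - N • vecMulVec (ψ i) (ψ i)))).PosSemidef := by
  have hN0 : 0 ≤ N := by rw [hN]; exact Nat.cast_nonneg _
  have hSsym : Sᵀ = S := by
    rw [← hS, transpose_sum]; exact Finset.sum_congr rfl fun i _ => transpose_vecMulVec _ _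
  have hSform : ∀ u, u ⬝ᵥ S *ᵥ u = ∑ i, (ψ i ⬝ᵥ u) ^ 2 := fun u => by
    rw [← hS, form_sum_vecMulVec]
  have hXle : ∀ i u, u ⬝ᵥ (θ • (S - N • vecMulVec (ψ i) (ψ i))) *ᵥ u ≤ u ⬝ᵥ u := fun i u => by
    rw [form_centred]
    have h1 : 0 ≤ N * (ψ i ⬝ᵥ u) ^ 2 := by positivity
    have h2 : 0 ≤ u ⬝ᵥ S *ᵥ u := by
      rw [hSform]; exact Finset.sum_nonneg fun i _ => sq_nonneg _
    nlinarith [hS1 u]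
  have h1 := posSemidef_sum Finset.univ fun i _ =>
    one_add_add_sq_sub_exp_posSemidef (centred_isSymm ψ S hS θ N i) (hXle i)
  have hsum0 : ∑ _i : κ, (1 : Matrix ι ι ℝ) = N • 1 := by
    rw [Finset.sum_const, Finset.card_univ, ← Nat.cast_smul_eq_nsmul ℝ, ← hN]
  have hsum1 : ∑ i, θ • (S - N • vecMulVec (ψ i) (ψ i)) = 0 := by
    rw [← Finset.smul_sum, Finset.sum_sub_distrib, ← Finset.smul_sum, hS, Finset.sum_const,
      Finset.card_univ, ← Nat.cast_smul_eq_nsmul ℝ, ← hN, sub_self, smul_zero]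
  have hsum2 : ∑ i, (θ • (S - N • vecMulVec (ψ i) (ψ i))) *
      (θ • (S - N • vecMulVec (ψ i) (ψ i))) =
      (θ ^ 2) • (N ^ 2 • ∑ i, (ψ i ⬝ᵥ ψ i) • vecMulVec (ψ i) (ψ i) - N • (S * S)) := by
    rw [← sum_centred_sq N hN _ _ (fun i => ?_) S hS, Finset.smul_sum]
    · refine Finset.sum_congr rfl fun i _ => ?_
      rw [Matrix.smul_mul, Matrix.mul_smul, smul_smul, pow_two]
    · rw [vecMulVec_mul_vecMulVec]
      ext a b
      simp [vecMulVec_apply]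
      ring
  rw [Finset.sum_sub_distrib, Finset.sum_add_distrib, Finset.sum_add_distrib, hsum0, hsum1, hsum2,
    add_zero] at h1
  have h2 : ((θ ^ 2 * N) • (d • (1 : Matrix ι ι ℝ)
      - N • ∑ i, (ψ i ⬝ᵥ ψ i) • vecMulVec (ψ i) (ψ i) + S * S)).PosSemidef := by
    refine posSemidef_of_form_nonneg ?_ fun u => ?_
    · rw [transpose_smul, transpose_add, transpose_sub, transpose_smul, transpose_smul,
        transpose_sum, transpose_mul, hSsym, transpose_one]
      simp only [transpose_smul, transpose_vecMulVec]
    · have hSS : 0 ≤ u ⬝ᵥ (S * S) *ᵥ u := by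
        rw [← mulVec_mulVec, dotProduct_mulVec, ← mulVec_transpose, hSsym]
        exact Finset.sum_nonneg fun i _ => mul_self_nonneg _
      have hle : N * ∑ i, (ψ i ⬝ᵥ ψ i) * (ψ i ⬝ᵥ u) ^ 2 ≤ d * (u ⬝ᵥ u) := by
        calc N * ∑ i, (ψ i ⬝ᵥ ψ i) * (ψ i ⬝ᵥ u) ^ 2
            = ∑ i, (N * (ψ i ⬝ᵥ ψ i)) * (ψ i ⬝ᵥ u) ^ 2 := by
              rw [Finset.mul_sum]; exact Finset.sum_congr rfl fun i _ => by ring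
          _ ≤ ∑ i, d * (ψ i ⬝ᵥ u) ^ 2 :=
              Finset.sum_le_sum fun i _ => mul_le_mul_of_nonneg_right (hd i) (sq_nonneg _)
          _ = d * (u ⬝ᵥ S *ᵥ u) := by rw [← Finset.mul_sum, hSform]
          _ ≤ d * (u ⬝ᵥ u) := mul_le_mul_of_nonneg_left (hS1 u) hd0
      have hform : u ⬝ᵥ (∑ i, (ψ i ⬝ᵥ ψ i) • vecMulVec (ψ i) (ψ i)) *ᵥ u =
          ∑ i, (ψ i ⬝ᵥ ψ i) * (ψ i ⬝ᵥ u) ^ 2 := by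
        rw [sum_mulVec, dotProduct_sum]
        refine Finset.sum_congr rfl fun i _ => ?_
        rw [smul_mulVec, dotProduct_smul, dotProduct_vecMulVec_self_mulVec, smul_eq_mul]
      rw [smul_mulVec, dotProduct_smul, add_mulVec, sub_mulVec, smul_mulVec, smul_mulVec,
        dotProduct_add, dotProduct_sub, dotProduct_smul, dotProduct_smul, one_mulVec, hform]
      simp only [smul_eq_mul]
      exact mul_nonneg (by positivity) (by linarith)
  have h3 := h1.add h2
  have e : ∀ A B E : Matrix ι ι ℝ, (N * (1 + θ ^ 2 * d)) • (1 : Matrix ι ι ℝ) - E =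
      N • (1 : Matrix ι ι ℝ) + θ ^ 2 • (N ^ 2 • A - N • B) - E
        + (θ ^ 2 * N) • (d • (1 : Matrix ι ι ℝ) - N • A + B) := fun A B E => by module
  rw [e]
  exact h3

/-- A Bernstein bound for the lower tail of a sum of random rank-one matrices, in counting form.
The vectors `ψ i` satisfy `∑ i, ψ i ψ iᵀ = S ≤ 1` and `‖ψ i‖² ≤ d / N`, where `N` is their number.
Among the `N ^ m` sequences of `m` indices, few are such that the selected vectors are all
orthogonal to a nonzero `u` with `uᵀ S u ≥ ‖u‖² / 2`. -/
lemma card_bad_sequences_le (ψ : κ → ι → ℝ) (S : Matrix ι ι ℝ)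
    (hS : ∑ i, vecMulVec (ψ i) (ψ i) = S) (hS1 : ∀ u, u ⬝ᵥ S *ᵥ u ≤ u ⬝ᵥ u)
    {N : ℝ} (hN : N = Fintype.card κ)
    {d : ℝ} (hd0 : 0 ≤ d) (hd : ∀ i, N * (ψ i ⬝ᵥ ψ i) ≤ d)
    {θ : ℝ} (hθ0 : 0 ≤ θ) (hθ1 : θ ≤ 1) (m : ℕ) (bad : Finset (Fin m → κ))
    (hbad : ∀ s ∈ bad, ∃ u, 0 < u ⬝ᵥ u ∧ (∀ j, ψ (s j) ⬝ᵥ u = 0) ∧ u ⬝ᵥ u / 2 ≤ u ⬝ᵥ S *ᵥ u) :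
    (bad.card : ℝ) * Real.exp (θ * m / 2) ≤ (N * (1 + θ ^ 2 * d)) ^ m * Fintype.card ι := by
  have hN0 : 0 ≤ N := by rw [hN]; exact Nat.cast_nonneg _
  have hsym : ∀ s : Fin m → κ, (∑ j, θ • (S - N • vecMulVec (ψ (s j)) (ψ (s j))))ᵀ =
      ∑ j, θ • (S - N • vecMulVec (ψ (s j)) (ψ (s j))) := fun s => by
    rw [transpose_sum]
    exact Finset.sum_congr rfl fun j _ => centred_isSymm ψ S hS θ N (s j)
  refine le_trans ?_ (sum_trace_exp_sum_le _ (centred_isSymm ψ S hS θ N) (by positivity)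
    (sum_exp_centred_le ψ S hS hS1 hN hd0 hd hθ0 hθ1) m)
  rw [← nsmul_eq_mul, ← Finset.sum_const]
  refine (Finset.sum_le_sum fun s hs => ?_).trans
    (Finset.sum_le_univ_sum_of_nonneg fun s => (exp_posSemidef (hsym s)).trace_nonneg)
  obtain ⟨u, hu0, hu, huS⟩ := hbad s hs
  refine exp_le_trace_exp (hsym s) hu0 ?_
  rw [sum_mulVec, dotProduct_sum,
    Finset.sum_congr rfl fun j _ => form_centred S (ψ (s j)) u θ N]
  simp only [hu]
  rw [Finset.sum_const, Finset.card_univ, Fintype.card_fin, nsmul_eq_mul]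
  have : 0 ≤ m * θ := by positivity
  nlinarith

end RandomSums

/-! ### Sampling with and without replacement -/

section Sampling

variable {n : ℕ}

lemma exists_perm_image_eq {M M' : Finset (Fin n)} (h : M.card = M'.card) :
    ∃ τ : Equiv.Perm (Fin n), M.image τ = M' := by
  have e : {x // x ∈ M} ≃ {x // x ∈ M'} := Finset.equivOfCardEq h
  refine ⟨e.extendSubtype, Finset.eq_of_subset_of_card_le (fun y hy => ?_) ?_⟩
  · obtain ⟨x, hx, rfl⟩ := Finset.mem_image.mp hy
    exact e.extendSubtype_mem x hx
  · rw [Finset.card_image_of_injective _ e.extendSubtype.injective, h]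

/-- A uniformly random relabelling of a fixed set of size `m` is a uniformly random such set. -/
lemma card_mul_sum_perm_image {m : ℕ} (f : Finset (Fin n) → ℝ) {M₀ : Finset (Fin n)}
    (hM₀ : M₀ ∈ powersetCard m (univ : Finset (Fin n))) :
    ((powersetCard m (univ : Finset (Fin n))).card : ℝ) *
        ∑ π : Equiv.Perm (Fin n), f (M₀.image π) =
      Fintype.card (Equiv.Perm (Fin n)) * ∑ M ∈ powersetCard m univ, f M := by
  have hconst : ∀ M ∈ powersetCard m (univ : Finset (Fin n)),
      ∑ π : Equiv.Perm (Fin n), f (M.image π) = ∑ π : Equiv.Perm (Fin n), f (M₀.image π) := by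
    intro M hM
    obtain ⟨τ, rfl⟩ := exists_perm_image_eq (M := M₀) (M' := M)
      ((mem_powersetCard.mp hM₀).2.trans (mem_powersetCard.mp hM).2.symm)
    rw [← Equiv.sum_comp (Equiv.mulRight τ) fun π : Equiv.Perm (Fin n) => f (M₀.image π)]
    refine Finset.sum_congr rfl fun π _ => ?_
    rw [Finset.image_image]
    rfl
  have hperm : ∀ π : Equiv.Perm (Fin n), ∑ M ∈ powersetCard m univ, f (M.image π) =
      ∑ M ∈ powersetCard m univ, f M := by
    intro π
    have hmem : ∀ (π : Equiv.Perm (Fin n)), ∀ M ∈ powersetCard m (univ : Finset (Fin n)),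
        M.image π ∈ powersetCard m univ := fun π M hM => mem_powersetCard.mpr
      ⟨subset_univ _, by
        rw [card_image_of_injective _ π.injective, (mem_powersetCard.mp hM).2]⟩
    refine Finset.sum_nbij' (fun M => M.image π) (fun M => M.image (π⁻¹ : Equiv.Perm (Fin n)))
      (hmem π) (hmem π⁻¹) (fun M _ => ?_) (fun M _ => ?_) (fun _ _ => rfl)
    · simp [Finset.image_image]
    · simp [Finset.image_image]
  rw [← nsmul_eq_mul, ← Finset.sum_const, ← Finset.sum_congr rfl hconst, Finset.sum_comm,
    Finset.sum_congr rfl fun π _ => hperm π, Finset.sum_const, nsmul_eq_mul, Finset.card_univ]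

/-- Sampling without replacement misses an upward closed family of sets at most as often as
sampling with replacement: after a random relabelling, a set of size `m` that contains the sampled
values is a uniformly distributed set of size `m`. -/
lemma card_bad_subsets_mul_le {m : ℕ} (hmn : m ≤ n) (good : Finset (Fin n) → Prop)
    [DecidablePred good] (hmono : ∀ M M', M ⊆ M' → good M → good M') :
    (((powersetCard m (univ : Finset (Fin n))).filter fun M => ¬ good M).card : ℝ) * n ^ m ≤
      ((univ.filter fun s : Fin m → Fin n => ¬ good (univ.image s)).card : ℝ)
        * (powersetCard m (univ : Finset (Fin n))).card := by
  set A := powersetCard m (univ : Finset (Fin n)) with hA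
  set f : Finset (Fin n) → ℝ := fun M => if ¬ good M then 1 else 0 with hf
  have hf1 : ((A.filter fun M => ¬ good M).card : ℝ) = ∑ M ∈ A, f M := by
    rw [Finset.card_filter]; push_cast; rfl
  have hf2 : ((univ.filter fun s : Fin m → Fin n => ¬ good (univ.image s)).card : ℝ) =
      ∑ s : Fin m → Fin n, f (univ.image s) := by
    rw [Finset.card_filter]; push_cast; rfl
  have hfm : ∀ M M', M ⊆ M' → f M' ≤ f M := by
    intro M M' h
    simp only [hf]
    have := hmono M M' h
    split_ifs <;> first | tauto | norm_num
  have hext : ∀ s : Fin m → Fin n, ∃ M ∈ A, univ.image s ⊆ M := by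
    intro s
    obtain ⟨M, hM1, -, hM2⟩ := Finset.exists_subsuperset_card_eq (subset_univ (univ.image s))
      (n := m) (by simpa using Finset.card_image_le (s := univ) (f := s)) (by simpa using hmn)
    exact ⟨M, mem_powersetCard.mpr ⟨subset_univ _, hM2⟩, hM1⟩
  choose M₀ hM₀ hsub using hext
  have hp : (0 : ℝ) < Fintype.card (Equiv.Perm (Fin n)) := by
    exact_mod_cast Fintype.card_pos
  have hshift : ∀ π : Equiv.Perm (Fin n),
      ∑ s : Fin m → Fin n, f ((univ.image s).image π) =
        ∑ s : Fin m → Fin n, f (univ.image s) := by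
    intro π
    rw [← (Equiv.arrowCongr (Equiv.refl (Fin m)) π).sum_comp fun s => f (univ.image s)]
    refine Finset.sum_congr rfl fun s _ => ?_
    rw [Finset.image_image]
    rfl
  rw [hf1, hf2]
  refine le_of_mul_le_mul_left ?_ hp
  calc (Fintype.card (Equiv.Perm (Fin n)) : ℝ) * ((∑ M ∈ A, f M) * n ^ m)
      = ∑ s : Fin m → Fin n, (Fintype.card (Equiv.Perm (Fin n)) : ℝ) * ∑ M ∈ A, f M := by
        rw [Finset.sum_const, Finset.card_univ, Fintype.card_fun, Fintype.card_fin,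
          Fintype.card_fin, nsmul_eq_mul]
        push_cast; ring
    _ = ∑ s : Fin m → Fin n, (A.card : ℝ) * ∑ π : Equiv.Perm (Fin n), f ((M₀ s).image π) :=
        Finset.sum_congr rfl fun s _ => (card_mul_sum_perm_image f (hM₀ s)).symm
    _ ≤ ∑ s : Fin m → Fin n, (A.card : ℝ) *
          ∑ π : Equiv.Perm (Fin n), f ((univ.image s).image π) := by
        gcongr with s _ π _
        exact hfm _ _ (Finset.image_subset_image (hsub s))
    _ = _ := by
        rw [← Finset.mul_sum, Finset.sum_comm, Finset.sum_congr rfl fun π _ => hshift π,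
          Finset.sum_const, nsmul_eq_mul, Finset.card_univ]
        ring

end Sampling

/-! ### Squared Euclidean norms -/

section DotProduct

variable {ι : Type*} [Fintype ι]

lemma dotProduct_mulVec_self_eq (A : Matrix ι ι ℝ) (u : ι → ℝ) :
    (A *ᵥ u) ⬝ᵥ (A *ᵥ u) = u ⬝ᵥ (Aᵀ * A) *ᵥ u := by
  rw [← mulVec_mulVec, dotProduct_mulVec u, vecMul_transpose]

lemma dotProduct_self_add_le (a b : ι → ℝ) :
    (a + b) ⬝ᵥ (a + b) ≤ 2 * (a ⬝ᵥ a) + 2 * (b ⬝ᵥ b) := by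
  have h : 0 ≤ (a - b) ⬝ᵥ (a - b) := Finset.sum_nonneg fun i _ => mul_self_nonneg _
  simp only [dotProduct_sub, sub_dotProduct, dotProduct_add, add_dotProduct,
    dotProduct_comm b a] at h ⊢
  linarith

end DotProduct

/-! ### The residual of a Nyström approximation -/

section NystromResidual

variable {ι κ : Type*} [Fintype ι] [Fintype κ] [DecidableEq κ]

/-- The range of `Jᵀ K` is contained in the range of `Jᵀ K J`, for `K = C²` with `C` symmetric. -/
lemma pseudoinverse_mul_cancel {C K : Matrix ι ι ℝ} (hC : Cᵀ = C) (hCK : C * C = K)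
    (J : Matrix ι κ ℝ) {Q : Matrix κ κ ℝ} (hQ : IsPseudoinverse (Jᵀ * K * J) Q) :
    Jᵀ * K * J * Q * (Jᵀ * K) = Jᵀ * K := by
  set E := 1 - Jᵀ * K * J * Q with hE
  have hEsym : Eᵀ = E := by rw [hE, transpose_sub, hQ.symm_left, transpose_one]
  have hE0 : E * (Jᵀ * K * J) = 0 := by
    rw [hE, Matrix.sub_mul, Matrix.one_mul, hQ.mul_mul_left, sub_self]
  have h0 : (E * (Jᵀ * C)) * (E * (Jᵀ * C))ᴴ = 0 := by
    rw [conjTranspose_eq_transpose_of_trivial, transpose_mul, hEsym, transpose_mul,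
      transpose_transpose, hC]
    calc E * (Jᵀ * C) * (C * J * E) = E * (Jᵀ * (C * C) * J) * E := by simp only [Matrix.mul_assoc]
      _ = 0 := by rw [hCK, hE0, Matrix.zero_mul]
  have h1 : E * (Jᵀ * C) = 0 := self_mul_conjTranspose_eq_zero.mp h0
  have h2 : E * (Jᵀ * K) = 0 := by
    rw [← hCK, ← Matrix.mul_assoc Jᵀ, ← Matrix.mul_assoc E, h1, Matrix.zero_mul]
  rw [hE, Matrix.sub_mul, Matrix.one_mul, sub_eq_zero] at h2
  exact h2.symm

variable [DecidableEq ι]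

/-- The residual `D = K - K J (Jᵀ K J)^† Jᵀ K` of the Nyström approximation equals `Wᵀ K W` for
`W = 1 - J (Jᵀ K J)^† Jᵀ K`, and vanishes on the selected coordinates. -/
lemma nystrom_residual_eq {C K : Matrix ι ι ℝ} (hC : Cᵀ = C) (hCK : C * C = K)
    (J : Matrix ι κ ℝ) {Q : Matrix κ κ ℝ} (hQ : IsPseudoinverse (Jᵀ * K * J) Q) (hQs : Qᵀ = Q) :
    Jᵀ * (K - K * J * Q * (Jᵀ * K)) = 0 ∧
    (1 - J * Q * (Jᵀ * K))ᵀ * (K - K * J * Q * (Jᵀ * K)) = K - K * J * Q * (Jᵀ * K) := by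
  have hKs : Kᵀ = K := by rw [← hCK, transpose_mul, hC]
  have h1 : Jᵀ * (K - K * J * Q * (Jᵀ * K)) = 0 := by
    rw [Matrix.mul_sub, sub_eq_zero, ← pseudoinverse_mul_cancel hC hCK J hQ]
    nth_rewrite 1 [← pseudoinverse_mul_cancel hC hCK J hQ]
    simp only [Matrix.mul_assoc]
  refine ⟨h1, ?_⟩
  have e : (1 - J * Q * (Jᵀ * K))ᵀ = 1 - K * J * Q * Jᵀ := by
    simp only [transpose_sub, transpose_one, transpose_mul, transpose_transpose, hKs, hQs,
      Matrix.mul_assoc]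
  rw [e, Matrix.sub_mul, Matrix.one_mul, Matrix.mul_assoc _ Jᵀ, h1, Matrix.mul_zero, sub_zero]

lemma nystrom_residual_form {C K : Matrix ι ι ℝ} (hC : Cᵀ = C) (hCK : C * C = K)
    (J : Matrix ι κ ℝ) {Q : Matrix κ κ ℝ} (hQ : IsPseudoinverse (Jᵀ * K * J) Q) (hQs : Qᵀ = Q)
    (a : ι → ℝ) :
    a ⬝ᵥ (K - K * J * Q * (Jᵀ * K)) *ᵥ a =
      (C *ᵥ ((1 - J * Q * (Jᵀ * K)) *ᵥ a)) ⬝ᵥ (C *ᵥ ((1 - J * Q * (Jᵀ * K)) *ᵥ a)) := by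
  have h : (1 - J * Q * (Jᵀ * K))ᵀ * (K * (1 - J * Q * (Jᵀ * K))) =
      K - K * J * Q * (Jᵀ * K) := by
    have e : K * (J * Q * (Jᵀ * K)) = K * J * Q * (Jᵀ * K) := by simp only [Matrix.mul_assoc]
    rw [Matrix.mul_sub K, Matrix.mul_one, e, (nystrom_residual_eq hC hCK J hQ hQs).2]
  rw [mulVec_mulVec, dotProduct_mulVec_self_eq, transpose_mul, hC, ← h, ← hCK]
  simp only [Matrix.mul_assoc]

lemma nystrom_residual_posSemidef {C K : Matrix ι ι ℝ} (hC : Cᵀ = C) (hCK : C * C = K)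
    (J : Matrix ι κ ℝ) {Q : Matrix κ κ ℝ} (hQ : IsPseudoinverse (Jᵀ * K * J) Q) (hQs : Qᵀ = Q) :
    (K - K * J * Q * (Jᵀ * K)).PosSemidef := by
  have hKs : Kᵀ = K := by rw [← hCK, transpose_mul, hC]
  refine posSemidef_of_form_nonneg ?_ fun u => ?_
  · simp only [transpose_sub, transpose_mul, transpose_transpose, hKs, hQs, Matrix.mul_assoc]
  · rw [nystrom_residual_form hC hCK J hQ hQs]
    exact Finset.sum_nonneg fun i _ => mul_self_nonneg _

/-- If `‖C w‖² ≤ c ‖w‖²` whenever `C w` vanishes on the selected coordinates, then the Nyström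
residual of `K = C²` is at most `c` in operator norm. -/
lemma nystrom_residual_norm_le {C K : Matrix ι ι ℝ} (hC : Cᵀ = C) (hCK : C * C = K)
    (J : Matrix ι κ ℝ) {Q : Matrix κ κ ℝ} (hQ : IsPseudoinverse (Jᵀ * K * J) Q) (hQs : Qᵀ = Q)
    {c : ℝ} (hgood : ∀ w, Jᵀ *ᵥ (C *ᵥ w) = 0 → (C *ᵥ w) ⬝ᵥ (C *ᵥ w) ≤ c * (w ⬝ᵥ w))
    (a : ι → ℝ) :
    ((K - K * J * Q * (Jᵀ * K)) *ᵥ a) ⬝ᵥ ((K - K * J * Q * (Jᵀ * K)) *ᵥ a) ≤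
      c ^ 2 * (a ⬝ᵥ a) := by
  have hD : C *ᵥ (C *ᵥ ((1 - J * Q * (Jᵀ * K)) *ᵥ a)) = (K - K * J * Q * (Jᵀ * K)) *ᵥ a := by
    rw [mulVec_mulVec, mulVec_mulVec, ← Matrix.mul_assoc, hCK, Matrix.mul_sub, Matrix.mul_one]
    simp only [Matrix.mul_assoc]
  have h := hgood (C *ᵥ ((1 - J * Q * (Jᵀ * K)) *ᵥ a)) (by
    rw [hD, mulVec_mulVec, (nystrom_residual_eq hC hCK J hQ hQs).1, zero_mulVec])
  rw [← nystrom_residual_form hC hCK J hQ hQs, hD] at h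
  set z := (K - K * J * Q * (Jᵀ * K)) *ᵥ a
  -- expand `0 ≤ ‖z - c a‖²`
  have h2 : 0 ≤ (z - c • a) ⬝ᵥ (z - c • a) := Finset.sum_nonneg fun i _ => mul_self_nonneg _
  rw [dotProduct_sub, sub_dotProduct, sub_dotProduct, dotProduct_smul, smul_dotProduct,
    dotProduct_smul, smul_dotProduct, dotProduct_comm z a] at h2
  simp only [smul_eq_mul] at h2
  linarith

end NystromResidual

/-! ### Spectral filters: gradient descent and Tikhonov regularization -/

section Filters

variable {ι : Type*} [Fintype ι] [DecidableEq ι]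

/-- The residual filter of gradient descent is dominated by that of Tikhonov regularization. -/
lemma one_sub_pow_mul_one_add_le {u : ℝ} (hu0 : 0 ≤ u) (hu1 : u ≤ 1) (t : ℕ) :
    (1 - u) ^ t * (1 + t * u) ≤ 1 := by
  have h1 : 1 + t * u ≤ (1 + u) ^ t := one_add_mul_le_pow (by linarith) t
  calc (1 - u) ^ t * (1 + t * u) ≤ (1 - u) ^ t * (1 + u) ^ t :=
        mul_le_mul_of_nonneg_left h1 (pow_nonneg (by linarith) t)
    _ = (1 - u ^ 2) ^ t := by rw [← mul_pow]; ring
    _ ≤ 1 := pow_le_one₀ (by nlinarith) (by nlinarith)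

/-- The filter of gradient descent is at most twice that of Tikhonov regularization. -/
lemma one_sub_one_sub_pow_le {u : ℝ} (hu0 : 0 ≤ u) (hu1 : u ≤ 1) (t : ℕ) :
    1 - (1 - u) ^ t ≤ 2 * (t * u / (1 + t * u)) := by
  have hs : 0 ≤ t * u := by positivity
  have h1 : 1 - t * u ≤ (1 - u) ^ t := by
    have := one_add_mul_le_pow (a := -u) (by linarith) t
    calc 1 - t * u = 1 + t * (-u) := by ring
      _ ≤ _ := by rw [sub_eq_add_neg]; exact this
  have h2 : 0 ≤ (1 - u) ^ t := pow_nonneg (by linarith) t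
  rw [← mul_div_assoc, le_div_iff₀ (by positivity)]
  by_cases h : t * u ≤ 1 <;> nlinarith

lemma landweber_residual_norm_le {B : Matrix ι ι ℝ} (hB : B.PosSemidef)
    (hB1 : ∀ u, u ⬝ᵥ B *ᵥ u ≤ u ⬝ᵥ u) (t : ℕ) (v : ι → ℝ) :
    ((1 - B) ^ t *ᵥ v) ⬝ᵥ ((1 - B) ^ t *ᵥ v) ≤ v ⬝ᵥ v := by
  obtain ⟨U, f, hU, hU', rfl⟩ := exists_eq_spectralMatrix (isSymm_of_posSemidef hB)
  have hf0 := eigenvalue_nonneg_of_form_nonneg hU (form_nonneg_of_posSemidef hB)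
  have hf1 := eigenvalue_le_of_form_le hU (a := 1) (by simpa only [one_mul] using hB1)
  rw [← spectralMatrix_one hU', spectralMatrix_sub, spectralMatrix_pow hU hU']
  refine (spectralMatrix_mulVec_norm_le hU hU' (a := 1) (fun i => ?_) v).trans (by simp)
  rw [abs_of_nonneg (pow_nonneg (by linarith [hf1 i]) t)]
  exact pow_le_one₀ (by linarith [hf1 i]) (by linarith [hf0 i])

/-- The bias of gradient descent on a perturbed problem: if `v = (1 + t B + E) q` with a
contraction `E`, then `‖(1 - B)^t v‖ ≤ 2 ‖q‖`. -/
lemma landweber_bias_le {B E : Matrix ι ι ℝ} (hB : B.PosSemidef)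
    (hB1 : ∀ u, u ⬝ᵥ B *ᵥ u ≤ u ⬝ᵥ u) (hE : ∀ u, (E *ᵥ u) ⬝ᵥ (E *ᵥ u) ≤ u ⬝ᵥ u)
    (t : ℕ) (q v : ι → ℝ) (hv : v = (1 + (t : ℝ) • B + E) *ᵥ q) :
    ((1 - B) ^ t *ᵥ v) ⬝ᵥ ((1 - B) ^ t *ᵥ v) ≤ 4 * (q ⬝ᵥ q) := by
  have h1 : (((1 - B) ^ t * (1 + (t : ℝ) • B)) *ᵥ q) ⬝ᵥ
      (((1 - B) ^ t * (1 + (t : ℝ) • B)) *ᵥ q) ≤ q ⬝ᵥ q := by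
    obtain ⟨U, f, hU, hU', rfl⟩ := exists_eq_spectralMatrix (isSymm_of_posSemidef hB)
    have hf0 := eigenvalue_nonneg_of_form_nonneg hU (form_nonneg_of_posSemidef hB)
    have hf1 := eigenvalue_le_of_form_le hU (a := 1) (by simpa only [one_mul] using hB1)
    rw [← spectralMatrix_one hU', spectralMatrix_sub, spectralMatrix_pow hU hU',
      spectralMatrix_smul, spectralMatrix_add, spectralMatrix_mul hU]
    refine (spectralMatrix_mulVec_norm_le hU hU' (a := 1) (fun i => ?_) q).trans (by simp)
    rw [abs_of_nonneg]
    · exact one_sub_pow_mul_one_add_le (hf0 i) (hf1 i) t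
    · have := hf0 i
      exact mul_nonneg (pow_nonneg (by linarith [hf1 i]) t) (by positivity)
  have h2 := (landweber_residual_norm_le hB hB1 t (E *ᵥ q)).trans (hE q)
  have e : (1 - B) ^ t *ᵥ v =
      ((1 - B) ^ t * (1 + (t : ℝ) • B)) *ᵥ q + (1 - B) ^ t *ᵥ (E *ᵥ q) := by
    rw [hv, add_mulVec _ E, mulVec_add, mulVec_mulVec]
  rw [e]
  linarith [dotProduct_self_add_le (((1 - B) ^ t * (1 + (t : ℝ) • B)) *ᵥ q)
    ((1 - B) ^ t *ᵥ (E *ᵥ q))]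

lemma spectralMatrix_add_smul_inv {U : Matrix ι ι ℝ} (hU : Uᵀ * U = 1) (hU' : U * Uᵀ = 1)
    {f : ι → ℝ} (hf : ∀ i, 0 ≤ f i) {c : ℝ} (hc : 0 < c) :
    (spectralMatrix U f + c • 1)⁻¹ = spectralMatrix U (fun i => (f i + c)⁻¹) := by
  refine Matrix.inv_eq_right_inv ?_
  rw [← spectralMatrix_one hU', spectralMatrix_smul, spectralMatrix_add, spectralMatrix_mul hU]
  congr 1
  ext i
  have := hf i
  rw [mul_one, mul_inv_cancel₀ (by positivity)]

lemma spectralMatrix_mul_add_smul_inv {U : Matrix ι ι ℝ} (hU : Uᵀ * U = 1) (hU' : U * Uᵀ = 1)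
    {f : ι → ℝ} (hf : ∀ i, 0 ≤ f i) {c : ℝ} (hc : 0 < c) :
    spectralMatrix U f * (spectralMatrix U f + c • 1)⁻¹ =
      spectralMatrix U (fun i => f i / (f i + c)) := by
  rw [spectralMatrix_add_smul_inv hU hU' hf hc, spectralMatrix_mul hU]
  simp only [div_eq_mul_inv]

lemma add_smul_one_mul_inv {K : Matrix ι ι ℝ} (hK : K.PosSemidef) {c : ℝ} (hc : 0 < c) :
    (K + c • 1) * (K + c • 1)⁻¹ = 1 ∧ (K + c • 1)⁻¹ * (K + c • 1) = 1 := by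
  obtain ⟨U, f, hU, hU', rfl⟩ := exists_eq_spectralMatrix (isSymm_of_posSemidef hK)
  have hf := eigenvalue_nonneg_of_form_nonneg hU (form_nonneg_of_posSemidef hK)
  have h : (spectralMatrix U f + c • 1) * (spectralMatrix U f + c • 1)⁻¹ = 1 := by
    rw [spectralMatrix_add_smul_inv hU hU' hf hc, ← spectralMatrix_one hU', spectralMatrix_smul,
      spectralMatrix_add, spectralMatrix_mul hU]
    congr 1
    ext i
    have := hf i
    rw [mul_one, mul_inv_cancel₀ (by positivity)]
  exact ⟨h, mul_eq_one_comm.mp h⟩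

lemma mul_add_smul_one_inv_comm {K : Matrix ι ι ℝ} (hK : K.PosSemidef) {c : ℝ} (hc : 0 < c) :
    K * (K + c • 1)⁻¹ = (K + c • 1)⁻¹ * K := by
  obtain ⟨h, h'⟩ := add_smul_one_mul_inv hK hc
  set P := (K + c • (1 : Matrix ι ι ℝ))⁻¹
  rw [add_mul, Matrix.smul_mul, one_mul, ← eq_sub_iff_add_eq] at h
  rw [mul_add, Matrix.mul_smul, mul_one, ← eq_sub_iff_add_eq] at h'
  rw [h, h']

lemma tikhonov_posSemidef {K : Matrix ι ι ℝ} (hK : K.PosSemidef) {c : ℝ} (hc : 0 < c) :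
    (K * (K + c • 1)⁻¹).PosSemidef := by
  obtain ⟨U, f, hU, hU', rfl⟩ := exists_eq_spectralMatrix (isSymm_of_posSemidef hK)
  have hf := eigenvalue_nonneg_of_form_nonneg hU (form_nonneg_of_posSemidef hK)
  rw [spectralMatrix_mul_add_smul_inv hU hU' hf hc]
  refine spectralMatrix_posSemidef fun i => ?_
  have := hf i
  positivity

/-- The matrix function `A ↦ A (A + c)⁻¹` is monotone in the Loewner order. -/
lemma tikhonov_sub_posSemidef {K L : Matrix ι ι ℝ} (hK : K.PosSemidef) (hL : L.PosSemidef)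
    (hKL : (K - L).PosSemidef) {c : ℝ} (hc : 0 < c) :
    (K * (K + c • 1)⁻¹ - L * (L + c • 1)⁻¹).PosSemidef := by
  obtain ⟨hP, hP'⟩ := add_smul_one_mul_inv hK hc
  obtain ⟨hN, hN'⟩ := add_smul_one_mul_inv hL hc
  have hNpsd : ((L + c • 1)⁻¹).PosSemidef :=
    (hL.add (Matrix.PosSemidef.one.smul hc.le)).inv
  have hPsym : (((K + c • 1)⁻¹)ᴴ) = (K + c • 1)⁻¹ :=
    (hK.add (Matrix.PosSemidef.one.smul hc.le)).inv.isHermitian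
  have hDsym : (K - L)ᴴ = K - L := hKL.isHermitian
  set P := (K + c • (1 : Matrix ι ι ℝ))⁻¹
  set N := (L + c • (1 : Matrix ι ι ℝ))⁻¹
  have hD : K - L = (K + c • 1) - (L + c • 1) := by abel
  have h1 : P * (K - L) * N = N - P := by
    rw [hD, mul_sub, sub_mul, hP', mul_assoc P, hN, one_mul, mul_one]
  have h2 : N * (K - L) * P = N - P := by
    rw [hD, mul_sub, sub_mul, hN', mul_assoc N, hP, one_mul, mul_one]
  have e : K * P - L * N = c • (P * (K - L) * P + P * ((K - L) * N * (K - L)) * P) := by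
    have e1 : P * (K - L) * P + P * ((K - L) * N * (K - L)) * P = N - P := by
      calc _ = P * (K - L) * (P + N * (K - L) * P) := by simp only [mul_add, mul_assoc]
        _ = N - P := by rw [h2, add_sub_cancel, h1]
    have e2 : K * P = 1 - c • P := by
      rw [eq_sub_iff_add_eq, ← hP, add_mul, Matrix.smul_mul, one_mul]
    have e3 : L * N = 1 - c • N := by
      rw [eq_sub_iff_add_eq, ← hN, add_mul, Matrix.smul_mul, one_mul]
    rw [e1, e2, e3, smul_sub]; abel
  rw [e]
  refine Matrix.PosSemidef.smul (.add ?_ ?_) hc.le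
  · have := hKL.mul_mul_conjTranspose_same P
    rwa [hPsym] at this
  · have h3 := hNpsd.mul_mul_conjTranspose_same (K - L)
    rw [hDsym] at h3
    have := h3.mul_mul_conjTranspose_same P
    rwa [hPsym] at this

/-- The variance of gradient descent on `L ≤ K` is at most four times that of Tikhonov
regularization on `K`. -/
lemma landweber_variance_le {K L : Matrix ι ι ℝ} (hK : K.PosSemidef) (hL : L.PosSemidef)
    (hKL : (K - L).PosSemidef) {c : ℝ} (hc : 0 < c) {t : ℕ} (ht : 0 < t)
    {B : Matrix ι ι ℝ} (hBL : B = (1 / (t * c)) • L) (hB1 : ∀ u, u ⬝ᵥ B *ᵥ u ≤ u ⬝ᵥ u) :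
    ((1 - (1 - B) ^ t) * (1 - (1 - B) ^ t)).trace ≤
      4 * (K * (K + c • 1)⁻¹ * (K * (K + c • 1)⁻¹)).trace := by
  have hLpsd := tikhonov_posSemidef hL hc
  have hKpsd := tikhonov_posSemidef hK hc
  have hsub := tikhonov_sub_posSemidef hK hL hKL hc
  have h1 : (L * (L + c • 1)⁻¹ * (L * (L + c • 1)⁻¹)).trace ≤
      (K * (K + c • 1)⁻¹ * (K * (K + c • 1)⁻¹)).trace := by
    have a1 := trace_mul_nonneg_of_posSemidef hLpsd hsub
    have a2 := trace_mul_nonneg_of_posSemidef hsub hKpsd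
    rw [mul_sub, trace_sub] at a1
    rw [sub_mul, trace_sub] at a2
    linarith
  refine le_trans ?_ (mul_le_mul_of_nonneg_left h1 (by norm_num))
  have ht' : (0 : ℝ) < t := by exact_mod_cast ht
  obtain ⟨U, f, hU, hU', rfl⟩ := exists_eq_spectralMatrix (isSymm_of_posSemidef hL)
  have hf0 := eigenvalue_nonneg_of_form_nonneg hU (form_nonneg_of_posSemidef hL)
  rw [spectralMatrix_smul] at hBL
  subst hBL
  have hf1 := eigenvalue_le_of_form_le hU (a := 1) (by simpa only [one_mul] using hB1)
  rw [spectralMatrix_mul_add_smul_inv hU hU' hf0 hc, ← spectralMatrix_one hU', spectralMatrix_sub,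
    spectralMatrix_pow hU hU', spectralMatrix_sub, spectralMatrix_mul hU, spectralMatrix_mul hU,
    trace_spectralMatrix hU, trace_spectralMatrix hU, Finset.mul_sum]
  refine Finset.sum_le_sum fun i _ => ?_
  have hfi := hf0 i
  have hu0 : 0 ≤ 1 / (t * c) * f i := by positivity
  have a1 := one_sub_one_sub_pow_le hu0 (hf1 i) t
  have a2 : 0 ≤ 1 - (1 - 1 / (t * c) * f i) ^ t :=
    sub_nonneg.mpr (pow_le_one₀ (by linarith [hf1 i]) (by linarith))
  have e : (t : ℝ) * (1 / (t * c) * f i) / (1 + t * (1 / (t * c) * f i)) = f i / (f i + c) := by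
    field_simp
    ring
  rw [e] at a1
  nlinarith

end Filters

/-! ### Random subsets and ridge leverage scores -/

section Subsets

variable {n : ℕ}

/-- The subset `M` is good for a square root `C` of the kernel matrix at level `c` if
`‖C w‖² ≤ c ‖w‖²` for all `w` such that `C w` vanishes on `M`. -/
def IsGoodSubset (C : Matrix (Fin n) (Fin n) ℝ) (c : ℝ) (M : Finset (Fin n)) : Prop :=
  ∀ w, (∀ i ∈ M, (C *ᵥ w) i = 0) → (C *ᵥ w) ⬝ᵥ (C *ᵥ w) ≤ c * (w ⬝ᵥ w)

lemma IsGoodSubset.mono {C : Matrix (Fin n) (Fin n) ℝ} {c : ℝ} {M M' : Finset (Fin n)}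
    (h : M ⊆ M') (hM : IsGoodSubset C c M) : IsGoodSubset C c M' :=
  fun w hw => hM w fun i hi => hw i (h hi)

open scoped Classical in
/-- Uniformly random subsets of size `m` are good with overwhelming probability, in terms of the
largest ridge leverage score `d / n`. -/
lemma exists_sqrt_card_not_isGoodSubset_le (hn : 0 < n) {K : Matrix (Fin n) (Fin n) ℝ}
    (hK : K.PosSemidef) {c : ℝ} (hc : 0 < c) {d : ℝ} (hd : 1 / 2 ≤ d)
    (hlev : ∀ i, n * (K * (K + c • (1 : Matrix (Fin n) (Fin n) ℝ))⁻¹) i i ≤ d)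
    {m : ℕ} (hmn : m ≤ n) :
    ∃ C : Matrix (Fin n) (Fin n) ℝ, Cᵀ = C ∧ C * C = K ∧
      (((powersetCard m univ).filter fun M => ¬ IsGoodSubset C c M).card : ℝ) ≤
        (powersetCard m (univ : Finset (Fin n))).card * (n * Real.exp (-(m / (16 * d)))) := by
  obtain ⟨U, f, hU, hU', rfl⟩ := exists_eq_spectralMatrix (isSymm_of_posSemidef hK)
  have hf := eigenvalue_nonneg_of_form_nonneg hU (form_nonneg_of_posSemidef hK)
  rw [spectralMatrix_mul_add_smul_inv hU hU' hf hc] at hlev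
  have hfc : ∀ i, 0 < f i + c := fun i => by linarith [hf i]
  set g : Fin n → ℝ := fun i => f i / (f i + c) with hg
  have hg0 : ∀ i, 0 ≤ g i := fun i => div_nonneg (hf i) (hfc i).le
  have hg1 : ∀ i, g i ≤ 1 := fun i => (div_le_one (hfc i)).mpr (by linarith)
  refine ⟨spectralMatrix U fun i => √(f i), spectralMatrix_transpose _, ?_, ?_⟩
  · rw [spectralMatrix_mul hU]
    congr 1
    ext i
    exact Real.mul_self_sqrt (hf i)
  set C := spectralMatrix U fun i => √(f i) with hC
  -- the rows of the square root of `K (K + c)⁻¹` are the vectors to sample from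
  set T := spectralMatrix U fun i => √(g i) with hT
  have hTT : T * T = spectralMatrix U g := by
    rw [spectralMatrix_mul hU]
    congr 1
    ext i
    exact Real.mul_self_sqrt (hg0 i)
  have hTsym : Tᵀ = T := spectralMatrix_transpose _
  have hrow : ∀ i u, T i ⬝ᵥ u = (T *ᵥ u) i := fun i u => rfl
  have hsum : ∑ i, vecMulVec (T i) (T i) = spectralMatrix U g := by
    rw [← hTT]
    ext a b
    rw [Matrix.sum_apply, Matrix.mul_apply]
    refine Finset.sum_congr rfl fun i _ => ?_
    rw [vecMulVec_apply]
    congr 1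
    exact congrFun (congrFun hTsym a) i ▸ rfl
  have hform1 : ∀ u, u ⬝ᵥ spectralMatrix U g *ᵥ u ≤ u ⬝ᵥ u := fun u => by
    rw [dotProduct_mulVec_spectralMatrix, dotProduct_self_eq_sum hU']
    exact Finset.sum_le_sum fun i _ => by nlinarith [sq_nonneg ((Uᵀ *ᵥ u) i), hg1 i]
  have hnorm : ∀ i, T i ⬝ᵥ T i = spectralMatrix U g i i := fun i => by
    rw [← hTT, Matrix.mul_apply]
    refine Finset.sum_congr rfl fun j _ => ?_
    congr 1
    exact congrFun (congrFun hTsym j) i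
  -- a set that is not good produces a vector orthogonal to the selected rows
  have hbad : ∀ s ∈ univ.filter fun s : Fin m → Fin n => ¬ IsGoodSubset C c (univ.image s),
      ∃ u, 0 < u ⬝ᵥ u ∧ (∀ j, T (s j) ⬝ᵥ u = 0) ∧
        u ⬝ᵥ u / 2 ≤ u ⬝ᵥ spectralMatrix U g *ᵥ u := by
    intro s hs
    have hs' := (Finset.mem_filter.mp hs).2
    simp only [IsGoodSubset, not_forall, not_le] at hs'
    obtain ⟨w, hw0, hw⟩ := hs'
    set V := spectralMatrix U fun i => √(f i + c) with hV
    have hTV : T *ᵥ (V *ᵥ w) = C *ᵥ w := by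
      rw [mulVec_mulVec, spectralMatrix_mul hU]
      congr 2
      ext i
      rw [← Real.sqrt_mul (hg0 i), div_mul_cancel₀ _ (hfc i).ne']
    have hVV : (V *ᵥ w) ⬝ᵥ (V *ᵥ w) = (C *ᵥ w) ⬝ᵥ (C *ᵥ w) + c * (w ⬝ᵥ w) := by
      rw [dotProduct_mulVec_self_eq, dotProduct_mulVec_self_eq, spectralMatrix_transpose,
        spectralMatrix_transpose, spectralMatrix_mul hU, spectralMatrix_mul hU,
        dotProduct_mulVec_spectralMatrix, dotProduct_mulVec_spectralMatrix,
        dotProduct_self_eq_sum hU', Finset.mul_sum, ← Finset.sum_add_distrib]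
      refine Finset.sum_congr rfl fun i _ => ?_
      rw [Real.mul_self_sqrt (hfc i).le, Real.mul_self_sqrt (hf i)]
      ring
    have hww : 0 ≤ w ⬝ᵥ w := Finset.sum_nonneg fun i _ => mul_self_nonneg _
    have hcw : 0 ≤ c * (w ⬝ᵥ w) := mul_nonneg hc.le hww
    refine ⟨V *ᵥ w, by linarith, fun j => ?_, ?_⟩
    · rw [hrow, hTV]
      exact hw0 _ (Finset.mem_image_of_mem _ (Finset.mem_univ j))
    · have : (V *ᵥ w) ⬝ᵥ spectralMatrix U g *ᵥ (V *ᵥ w) = (C *ᵥ w) ⬝ᵥ (C *ᵥ w) := by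
        rw [← hTV, dotProduct_mulVec_self_eq T, hTsym, hTT]
      linarith
  have hd0 : 0 < d := by linarith
  have hθ : 1 / (4 * d) ≤ 1 := (div_le_one (by positivity)).mpr (by linarith)
  -- `θ = 1 / (4 d)` maximizes the exponent `θ m / 2 - θ² d m`
  have hseq := card_bad_sequences_le (fun i => T i) (spectralMatrix U g) hsum hform1
    (N := n) (by simp) hd0.le (fun i => by rw [hnorm]; exact hlev i)
    (θ := 1 / (4 * d)) (by positivity) hθ m _ hbad
  have hsub := card_bad_subsets_mul_le hmn (IsGoodSubset C c)
    fun M M' h hM => IsGoodSubset.mono h hM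
  set b : ℝ := ((univ.filter fun s : Fin m → Fin n =>
    ¬ IsGoodSubset C c (univ.image s)).card : ℝ)
  have hn' : (0 : ℝ) < n := by exact_mod_cast hn
  have hb : b ≤ n ^ m * (n * Real.exp (-(m / (16 * d)))) := by
    have h1 : (n * (1 + (1 / (4 * d)) ^ 2 * d)) ^ m ≤ (n : ℝ) ^ m * Real.exp (m / (16 * d)) := by
      rw [mul_pow]
      refine mul_le_mul_of_nonneg_left ?_ (by positivity)
      have h2 : 1 + (1 / (4 * d)) ^ 2 * d ≤ Real.exp (1 / (16 * d)) := by
        have := Real.add_one_le_exp (1 / (16 * d))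
        have e : (1 / (4 * d)) ^ 2 * d = 1 / (16 * d) := by field_simp; norm_num
        linarith
      calc (1 + (1 / (4 * d)) ^ 2 * d) ^ m ≤ Real.exp (1 / (16 * d)) ^ m :=
            pow_le_pow_left₀ (by positivity) h2 m
        _ = Real.exp (m / (16 * d)) := by rw [← Real.exp_nat_mul]; congr 1; ring
    rw [Fintype.card_fin] at hseq
    have h3 := hseq.trans (mul_le_mul_of_nonneg_right h1 hn'.le)
    have e1 : (1 / (4 * d) * m / 2 : ℝ) = m / (16 * d) + m / (16 * d) := by field_simp; ring
    rw [e1, Real.exp_add, ← mul_assoc] at h3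
    have hpos := Real.exp_pos (m / (16 * d))
    rw [Real.exp_neg]
    have h4 : b * Real.exp (m / (16 * d)) ≤ n ^ m * n := by
      refine le_of_mul_le_mul_right ?_ hpos
      linarith
    rw [← mul_assoc, ← div_eq_mul_inv, le_div_iff₀ hpos]
    exact h4
  have hnm : (0 : ℝ) < n ^ m := by positivity
  refine le_of_mul_le_mul_right (hsub.trans ?_) hnm
  calc b * ((powersetCard m (univ : Finset (Fin n))).card : ℝ)
      ≤ (n ^ m * (n * Real.exp (-(m / (16 * d))))) * (powersetCard m univ).card :=
        mul_le_mul_of_nonneg_right hb (Nat.cast_nonneg _)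
    _ = _ := by ring

end Subsets

/-! ### Eigenvalues and the spectral norm -/

section SpecNorm

variable {n : ℕ}

lemma norm_toLp_sq (u : Fin n → ℝ) :
    ‖(WithLp.toLp 2 u : EuclideanSpace ℝ (Fin n))‖ ^ 2 = u ⬝ᵥ u := by
  rw [EuclideanSpace.norm_sq_eq]
  simp [dotProduct, pow_two]

lemma eigenvalue_le_specNorm {U : Matrix (Fin n) (Fin n) ℝ} (hU : Uᵀ * U = 1) (f : Fin n → ℝ)
    (i : Fin n) : f i ≤ specNorm (spectralMatrix U f) := by
  have h := (Matrix.toEuclideanCLM (n := Fin n) (𝕜 := ℝ) (spectralMatrix U f)).le_opNorm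
    (WithLp.toLp 2 (U *ᵥ Pi.single i 1))
  rw [Matrix.toEuclideanCLM_toLp, spectralMatrix_col hU, WithLp.toLp_smul, norm_smul] at h
  have h1 : ‖(WithLp.toLp 2 (U *ᵥ Pi.single i 1) : EuclideanSpace ℝ (Fin n))‖ = 1 := by
    have := norm_toLp_sq (U *ᵥ Pi.single i 1)
    rw [dotProduct_col_self hU] at this
    exact (pow_eq_one_iff_of_nonneg (norm_nonneg _) two_ne_zero).mp this
  rw [h1, mul_one, mul_one] at h
  exact (le_abs_self _).trans h

lemma exists_specNorm_le_eigenvalue (hn : 0 < n) {U : Matrix (Fin n) (Fin n) ℝ} (hU : Uᵀ * U = 1)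
    (hU' : U * Uᵀ = 1) {f : Fin n → ℝ} (hf : ∀ i, 0 ≤ f i) :
    ∃ i, specNorm (spectralMatrix U f) ≤ f i := by
  have : Nonempty (Fin n) := ⟨⟨0, hn⟩⟩
  obtain ⟨i, hi⟩ := Finite.exists_max f
  refine ⟨i, ContinuousLinearMap.opNorm_le_bound _ (hf i) fun z => ?_⟩
  have h := spectralMatrix_mulVec_norm_le hU hU' (f := f) (a := f i)
    (fun j => by rw [abs_of_nonneg (hf j)]; exact hi j) (WithLp.ofLp z)
  rw [← norm_toLp_sq, ← norm_toLp_sq, ← mul_pow] at h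
  exact le_of_sq_le_sq h (mul_nonneg (hf i) (norm_nonneg _))

end SpecNorm

/-! ### Spectral norm and maximal leverage -/

section SpecNormPosSemidef

variable {n : ℕ} {K : Matrix (Fin n) (Fin n) ℝ}

lemma form_le_specNorm (hK : K.PosSemidef) (u : Fin n → ℝ) :
    u ⬝ᵥ K *ᵥ u ≤ specNorm K * (u ⬝ᵥ u) := by
  obtain ⟨U, f, hU, hU', rfl⟩ := exists_eq_spectralMatrix (isSymm_of_posSemidef hK)
  rw [dotProduct_mulVec_spectralMatrix, dotProduct_self_eq_sum hU', Finset.mul_sum]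
  exact Finset.sum_le_sum fun i _ =>
    mul_le_mul_of_nonneg_right (eigenvalue_le_specNorm hU f i) (sq_nonneg _)

lemma specNorm_pos (h : K ≠ 0) : 0 < specNorm K := by
  refine norm_pos_iff.mpr fun h0 => h ?_
  exact (map_eq_zero_iff _ (Matrix.toEuclideanCLM (n := Fin n) (𝕜 := ℝ)).injective).mp h0

lemma le_dTilde (K : Matrix (Fin n) (Fin n) ℝ) (lam : ℝ) (i : Fin n) :
    n * (K * (K + (lam * n) • (1 : Matrix (Fin n) (Fin n) ℝ))⁻¹) i i ≤ dTilde K lam :=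
  mul_le_mul_of_nonneg_left (le_ciSup (f := fun i =>
    (K * (K + (lam * n) • (1 : Matrix (Fin n) (Fin n) ℝ))⁻¹) i i) (Set.finite_range _).bddAbove i)
    (Nat.cast_nonneg _)

/-- The maximal leverage dominates the effective dimension, which is at least `1 / 2` as soon as
the regularization is at most the largest eigenvalue. -/
lemma half_le_dTilde (hn : 0 < n) (hK : K.PosSemidef) {lam : ℝ} (hlam : 0 < lam * n)
    (hle : lam * n ≤ specNorm K) : 1 / 2 ≤ dTilde K lam := by
  have htr : (K * (K + (lam * n) • (1 : Matrix (Fin n) (Fin n) ℝ))⁻¹).trace ≤ dTilde K lam := by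
    have hn' : (0 : ℝ) < n := by exact_mod_cast hn
    rw [← mul_le_mul_iff_right₀ hn', Matrix.trace, Finset.mul_sum]
    refine (Finset.sum_le_sum fun i _ => le_dTilde K lam i).trans ?_
    rw [Finset.sum_const, Finset.card_univ, Fintype.card_fin, nsmul_eq_mul]
  refine le_trans ?_ htr
  obtain ⟨U, f, hU, hU', rfl⟩ := exists_eq_spectralMatrix (isSymm_of_posSemidef hK)
  have hf := eigenvalue_nonneg_of_form_nonneg hU (form_nonneg_of_posSemidef hK)
  rw [spectralMatrix_mul_add_smul_inv hU hU' hf hlam, trace_spectralMatrix hU]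
  obtain ⟨i, hi⟩ := exists_specNorm_le_eigenvalue hn hU hU' hf
  have hpos : ∀ j, 0 < f j + lam * n := fun j => by linarith [hf j]
  refine le_trans ?_ (Finset.single_le_sum (f := fun j => f j / (f j + lam * n))
    (fun j _ => div_nonneg (hf j) (hpos j).le) (Finset.mem_univ i))
  rw [div_le_div_iff₀ two_pos (hpos i)]
  linarith

end SpecNormPosSemidef

/-! ### The bias averaged over random subsets -/

section AverageBias

variable {n : ℕ}

/-- The selection matrix of `M`: its columns are the standard basis vectors indexed by `M`. -/
def selection (M : Finset (Fin n)) : Matrix (Fin n) M ℝ :=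
  (1 : Matrix (Fin n) (Fin n) ℝ).submatrix id (↑)

lemma mul_selection (A : Matrix (Fin n) (Fin n) ℝ) (M : Finset (Fin n)) :
    A * selection M = A.submatrix id (↑) := by
  ext i j
  simp [selection, Matrix.mul_apply, Matrix.one_apply]

lemma selection_transpose_mulVec (M : Finset (Fin n)) (z : Fin n → ℝ) (i : M) :
    ((selection M)ᵀ *ᵥ z) i = z i := by
  simp [selection, mulVec, dotProduct, Matrix.one_apply]

/-- The Nyström approximation `K J (Jᵀ K J)^† Jᵀ K`, for the pseudoinverse `Q` of `Jᵀ K J`. -/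
def nystrom (K : Matrix (Fin n) (Fin n) ℝ) (M : Finset (Fin n)) (Q : Matrix M M ℝ) :
    Matrix (Fin n) (Fin n) ℝ :=
  K * selection M * Q * ((selection M)ᵀ * K)

/-- For `n ≤ t`, the probability that a subset is not good, times the ratio `(1 + t / n)²` of
squared biases that holds for every subset, is small. -/
lemma failure_mul_le {n t m : ℕ} {d δ : ℝ} (hn : 0 < n) (hnt : n ≤ t) (hd : 1 / 2 ≤ d)
    (hδ0 : 0 < δ) (hδ1 : δ < 1)
    (hm : (32 * d / δ + 2) * Real.log (n * t / δ) ≤ (m : ℝ)) :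
    n * Real.exp (-(m / (16 * d))) * (1 + t / n) ^ 2 ≤ 16 * δ := by
  have hn1 : (1 : ℝ) ≤ n := by exact_mod_cast hn
  have hnt' : (n : ℝ) ≤ t := by exact_mod_cast hnt
  have ht1 : (1 : ℝ) ≤ t := hn1.trans hnt'
  have hr : 1 ≤ n * t / δ := by
    rw [le_div_iff₀ hδ0]; nlinarith
  have hlog : 0 ≤ Real.log (n * t / δ) := Real.log_nonneg hr
  have hd0 : 0 < d := by linarith
  have h1 : 2 * Real.log (n * t / δ) ≤ m / (16 * d) := by
    rw [le_div_iff₀ (by positivity)]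
    refine le_trans ?_ hm
    have : 32 * d ≤ 32 * d / δ := by
      rw [le_div_iff₀ hδ0]; nlinarith
    nlinarith
  have h2 : Real.exp (-(m / (16 * d))) ≤ (δ / (n * t)) ^ 2 := by
    calc Real.exp (-(m / (16 * d))) ≤ Real.exp (-(2 * Real.log (n * t / δ))) :=
          Real.exp_le_exp.mpr (by linarith)
      _ = (δ / (n * t)) ^ 2 := by
          rw [Real.exp_neg, two_mul, Real.exp_add, Real.exp_log (by linarith), ← pow_two,
            ← inv_pow, inv_div]
  have h3 : (1 + t / n : ℝ) ≤ 2 * (t / n) := by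
    have : (1 : ℝ) ≤ t / n := by rw [le_div_iff₀ (by linarith)]; linarith
    linarith
  calc n * Real.exp (-(m / (16 * d))) * (1 + t / n) ^ 2
      ≤ n * (δ / (n * t)) ^ 2 * (2 * (t / n)) ^ 2 := by gcongr
    _ = 4 * δ ^ 2 / n ^ 3 := by field_simp; norm_num
    _ ≤ 16 * δ := by
        rw [div_le_iff₀ (by positivity)]
        have : 1 ≤ (n : ℝ) ^ 3 := one_le_pow₀ hn1
        nlinarith

variable {K : Matrix (Fin n) (Fin n) ℝ} {c κ : ℝ} {t : ℕ}

/-- The gradient descent step for the Nyström kernel matrix is a contraction. -/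
lemma nystrom_step_form_le (hn : 0 < n) (hK : K.PosSemidef) (hκ : κ = specNorm K) (hκ0 : 0 < κ)
    (hc : t * c = n * κ) {L : Matrix (Fin n) (Fin n) ℝ}
    (hKL : (K - L).PosSemidef) (u : Fin n → ℝ) :
    u ⬝ᵥ ((1 / (t * c)) • L) *ᵥ u ≤ u ⬝ᵥ u := by
  have hn1 : (1 : ℝ) ≤ n := by exact_mod_cast hn
  have h1 := form_le_specNorm hK u
  have h2 := form_nonneg_of_posSemidef hKL u
  rw [sub_mulVec, dotProduct_sub] at h2
  have h3 : 0 ≤ u ⬝ᵥ u := Finset.sum_nonneg fun i _ => mul_self_nonneg _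
  rw [smul_mulVec, dotProduct_smul, smul_eq_mul, hc, one_div, inv_mul_le_iff₀ (by positivity)]
  rw [← hκ] at h1
  have : κ * (u ⬝ᵥ u) ≤ n * κ * (u ⬝ᵥ u) := by
    rw [mul_assoc]; exact le_mul_of_one_le_left (by positivity) hn1
  linarith

/-- Averaged over random subsets, the squared bias of NYTRO is at most `4 (1 + 4 δ)` times the
squared bias `‖q‖²` of KRLS, where `q = lam n (K + lam n)⁻¹ v`. -/
lemma sum_bias_le (hn : 0 < n) (hK : K.PosSemidef) (hκ : κ = specNorm K) (hκ0 : 0 < κ)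
    (ht : 0 < t) {lam : ℝ} (hlam : t * (lam * n) = n * κ) {δ : ℝ} (hδ0 : 0 < δ) (hδ1 : δ < 1)
    {m : ℕ} (hmn : m ≤ n)
    (hm : (32 * dTilde K lam / δ + 2) * Real.log (n * t / δ) ≤ (m : ℝ))
    (Q : ∀ M : Finset (Fin n), Matrix M M ℝ)
    (hQ : ∀ M, IsPseudoinverse ((selection M)ᵀ * K * selection M) (Q M))
    (hQs : ∀ M, (Q M)ᵀ = Q M) (hL : ∀ M, (nystrom K M (Q M)).PosSemidef)
    (hKL : ∀ M, (K - nystrom K M (Q M)).PosSemidef)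
    (q v : Fin n → ℝ) (hv : (lam * n) • v = (K + (lam * n) • 1) *ᵥ q) :
    ∑ M ∈ powersetCard m univ,
        ((1 - (1 / (t * (lam * n))) • nystrom K M (Q M)) ^ t *ᵥ v) ⬝ᵥ
        ((1 - (1 / (t * (lam * n))) • nystrom K M (Q M)) ^ t *ᵥ v) ≤
      (powersetCard m (univ : Finset (Fin n))).card * (4 * (1 + 4 * δ) * (q ⬝ᵥ q)) := by
  classical
  set c := lam * n with hc
  have hn0 : (0 : ℝ) < n := by exact_mod_cast hn
  have ht0 : (0 : ℝ) < t := by exact_mod_cast ht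
  have hc0 : 0 < c := by
    have : 0 < t * c := by rw [hlam]; positivity
    exact (mul_pos_iff_of_pos_left ht0).mp this
  have hq0 : 0 ≤ q ⬝ᵥ q := Finset.sum_nonneg fun i _ => mul_self_nonneg _
  set B : Finset (Fin n) → Matrix (Fin n) (Fin n) ℝ :=
    fun M => (1 / (t * c)) • nystrom K M (Q M) with hB
  have hBpsd : ∀ M, (B M).PosSemidef := fun M => (hL M).smul (by positivity)
  have hB1 : ∀ M u, u ⬝ᵥ B M *ᵥ u ≤ u ⬝ᵥ u := fun M u =>
    nystrom_step_form_le hn hK hκ hκ0 hlam (hKL M) u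
  -- any subset: the filter is a contraction and `‖v‖ ≤ (1 + t / n) ‖q‖`
  have hvq : v ⬝ᵥ v ≤ (1 + t / n) ^ 2 * (q ⬝ᵥ q) := by
    obtain ⟨U, f, hU, hU', rfl⟩ := exists_eq_spectralMatrix (isSymm_of_posSemidef hK)
    have hf := eigenvalue_nonneg_of_form_nonneg hU (form_nonneg_of_posSemidef hK)
    have e : v = spectralMatrix U (fun i => c⁻¹ * (f i + c)) *ᵥ q := by
      rw [← spectralMatrix_smul, ← spectralMatrix_add, smul_mulVec]
      have : spectralMatrix U (fun _ => c) = c • 1 := by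
        rw [← spectralMatrix_one hU', spectralMatrix_smul, mul_one]
      rw [this, ← hv, smul_smul, inv_mul_cancel₀ hc0.ne', one_smul]
    rw [e]
    refine spectralMatrix_mulVec_norm_le hU hU' (fun i => ?_) q
    have hfi := hf i
    rw [abs_of_nonneg (by positivity)]
    have h1 : f i ≤ κ := hκ ▸ eigenvalue_le_specNorm hU f i
    have h2 : κ = c * (t / n) := by
      rw [← mul_div_assoc, eq_div_iff hn0.ne']; linarith
    rw [inv_mul_le_iff₀ hc0]
    linarith
  have hany : ∀ M, ((1 - B M) ^ t *ᵥ v) ⬝ᵥ ((1 - B M) ^ t *ᵥ v) ≤ (1 + t / n) ^ 2 * (q ⬝ᵥ q) :=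
    fun M => (landweber_residual_norm_le (hBpsd M) (hB1 M) t v).trans hvq
  rcases le_total t n with htn | hnt
  · refine (Finset.sum_le_card_nsmul _ _ (4 * (1 + 4 * δ) * (q ⬝ᵥ q)) fun M _ =>
      (hany M).trans ?_).trans_eq (nsmul_eq_mul _ _)
    have h1 : (t / n : ℝ) ≤ 1 := by
      rw [div_le_one hn0]; exact_mod_cast htn
    have h2 : (1 + t / n : ℝ) ^ 2 ≤ 4 := by
      have : (0 : ℝ) ≤ t / n := by positivity
      nlinarith
    have h3 : (1 + t / n : ℝ) ^ 2 ≤ 4 * (1 + 4 * δ) := by linarith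
    exact mul_le_mul_of_nonneg_right h3 hq0
  · have hcκ : c ≤ κ := by
      have h1 : (n : ℝ) ≤ t := by exact_mod_cast hnt
      have h2 : n * c ≤ n * κ := by
        rw [← hlam]; exact mul_le_mul_of_nonneg_right h1 hc0.le
      exact le_of_mul_le_mul_left h2 hn0
    have hd := half_le_dTilde hn hK hc0 (hκ ▸ hcκ)
    obtain ⟨C, hCs, hCK, hfail⟩ := exists_sqrt_card_not_isGoodSubset_le hn hK hc0 hd
      (le_dTilde K lam) hmn
    have hgood : ∀ M, IsGoodSubset C c M →
        ((1 - B M) ^ t *ᵥ v) ⬝ᵥ ((1 - B M) ^ t *ᵥ v) ≤ 4 * (q ⬝ᵥ q) := by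
      intro M hM
      have hD := nystrom_residual_norm_le hCs hCK (selection M) (hQ M) (hQs M) (c := c)
        fun w hw => hM w fun i hi => by
          have := congrFun hw ⟨i, hi⟩
          rwa [selection_transpose_mulVec] at this
      refine landweber_bias_le (E := c⁻¹ • (K - nystrom K M (Q M))) (hBpsd M) (hB1 M)
        (fun u => ?_) t q v ?_
      · rw [smul_mulVec, dotProduct_smul, smul_dotProduct, smul_eq_mul, smul_eq_mul, ← mul_assoc,
          ← pow_two, inv_pow, inv_mul_le_iff₀ (by positivity)]
        exact hD u
      · have e : 1 + (t : ℝ) • B M + c⁻¹ • (K - nystrom K M (Q M)) =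
            c⁻¹ • (K + c • (1 : Matrix (Fin n) (Fin n) ℝ)) := by
          have e1 : (t : ℝ) • B M = c⁻¹ • nystrom K M (Q M) := by
            rw [hB, smul_smul]
            congr 1
            field_simp
          rw [e1, smul_sub, smul_add, smul_smul, inv_mul_cancel₀ hc0.ne', one_smul]
          abel
        rw [e, smul_mulVec, ← hv, smul_smul, inv_mul_cancel₀ hc0.ne', one_smul]
    set A := powersetCard m (univ : Finset (Fin n)) with hA
    have hnum := failure_mul_le hn hnt hd hδ0 hδ1 hm
    set p : ℝ := n * Real.exp (-(m / (16 * dTilde K lam))) with hp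
    have hA0 : (0 : ℝ) ≤ A.card := Nat.cast_nonneg _
    have hr0 : 0 ≤ (1 + t / n : ℝ) ^ 2 * (q ⬝ᵥ q) := by positivity
    calc ∑ M ∈ A, ((1 - B M) ^ t *ᵥ v) ⬝ᵥ ((1 - B M) ^ t *ᵥ v)
        ≤ ∑ M ∈ A, (4 * (q ⬝ᵥ q) +
            if ¬ IsGoodSubset C c M then (1 + t / n) ^ 2 * (q ⬝ᵥ q) else 0) := by
          refine Finset.sum_le_sum fun M _ => ?_
          by_cases hM : IsGoodSubset C c M
          · simpa [hM] using hgood M hM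
          · simp only [hM, not_false_eq_true, if_true]
            linarith [hany M]
      _ = A.card * (4 * (q ⬝ᵥ q)) + ((A.filter fun M => ¬ IsGoodSubset C c M).card : ℝ) *
            ((1 + t / n) ^ 2 * (q ⬝ᵥ q)) := by
          rw [Finset.sum_add_distrib, Finset.sum_const, nsmul_eq_mul, ← Finset.sum_filter,
            Finset.sum_const, nsmul_eq_mul]
      _ ≤ A.card * (4 * (q ⬝ᵥ q)) + A.card * p * ((1 + t / n) ^ 2 * (q ⬝ᵥ q)) :=
          add_le_add le_rfl (mul_le_mul_of_nonneg_right hfail hr0)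
      _ = A.card * (4 * (q ⬝ᵥ q)) + A.card * (p * (1 + t / n) ^ 2) * (q ⬝ᵥ q) := by ring
      _ ≤ A.card * (4 * (q ⬝ᵥ q)) + A.card * (16 * δ) * (q ⬝ᵥ q) := by gcongr
      _ = _ := by ring

end AverageBias

/-! ### Quadratic functionals of the noise -/

section Noise

variable {Ω : Type*} [MeasurableSpace Ω] {P : Measure Ω} {n : ℕ}

/-- The second order properties of the noise: square integrable, centred, and uncorrelated with
common variance `σ²`. -/
structure IsWhiteNoise (P : Measure Ω) (σ : ℝ) (ε : Fin n → Ω → ℝ) : Prop where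
  memLp : ∀ i, MemLp (ε i) 2 P
  integral_eq_zero : ∀ i, ∫ ω, ε i ω ∂P = 0
  integral_mul : ∀ i j, ∫ ω, ε i ω * ε j ω ∂P = if i = j then σ ^ 2 else 0

lemma isWhiteNoise_of_iid [IsProbabilityMeasure P] {ρ : Measure ℝ} {σ : ℝ} (hρ2 : MemLp id 2 ρ)
    (hρmean : ∫ s, s ∂ρ = 0) (hρvar : variance id ρ = σ ^ 2) {ε : Fin n → Ω → ℝ}
    (hlaw : ∀ i, HasLaw (ε i) ρ P) (hindep : iIndepFun ε P) : IsWhiteNoise P σ ε := by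
  have hmem : ∀ i, MemLp (ε i) 2 P := fun i => by
    have h := hρ2
    rw [← (hlaw i).map_eq] at h
    exact (memLp_map_measure_iff aestronglyMeasurable_id (hlaw i).aemeasurable).mp h
  have hmean : ∀ i, ∫ ω, ε i ω ∂P = 0 := fun i => by
    rw [(hlaw i).integral_eq, hρmean]
  refine ⟨hmem, hmean, fun i j => ?_⟩
  split_ifs with h
  · subst h
    rw [← hρvar, ← (hlaw i).variance_eq, variance_of_integral_eq_zero (hlaw i).aemeasurable
      (hmean i)]
    simp [pow_two]
  · rw [(hindep.indepFun h).integral_fun_mul_eq_mul_integral (hmem i).1 (hmem j).1, hmean i,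
      zero_mul]

variable {σ : ℝ} {ε : Fin n → Ω → ℝ}

/-- The bias–variance decomposition of a random quadratic functional of the noise. -/
lemma IsWhiteNoise.integral_norm_sq [IsProbabilityMeasure P] (h : IsWhiteNoise P σ ε)
    (T : Matrix (Fin n) (Fin n) ℝ) (b : Fin n → ℝ) :
    Integrable (fun ω => (T *ᵥ (fun i => ε i ω) - b) ⬝ᵥ (T *ᵥ (fun i => ε i ω) - b)) P ∧
    ∫ ω, (T *ᵥ (fun i => ε i ω) - b) ⬝ᵥ (T *ᵥ (fun i => ε i ω) - b) ∂P =
      b ⬝ᵥ b + σ ^ 2 * (Tᵀ * T).trace := by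
  obtain ⟨G, hG⟩ : ∃ G, G = Tᵀ * T := ⟨_, rfl⟩
  obtain ⟨g, hg⟩ : ∃ g, g = Tᵀ *ᵥ b := ⟨_, rfl⟩
  have e : ∀ ω, (T *ᵥ (fun i => ε i ω) - b) ⬝ᵥ (T *ᵥ (fun i => ε i ω) - b) =
      ∑ i, ∑ j, G i j * (ε i ω * ε j ω) - ∑ j, 2 * g j * ε j ω + b ⬝ᵥ b := by
    intro ω
    rw [dotProduct_sub, sub_dotProduct, sub_dotProduct, dotProduct_mulVec_self_eq,
      dotProduct_comm (T *ᵥ _) b, dotProduct_mulVec b, ← mulVec_transpose, ← hG, ← hg]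
    have e1 : (fun i => ε i ω) ⬝ᵥ G *ᵥ (fun i => ε i ω) =
        ∑ i, ∑ j, G i j * (ε i ω * ε j ω) := by
      simp only [dotProduct, mulVec, Finset.mul_sum]
      exact Finset.sum_congr rfl fun i _ => Finset.sum_congr rfl fun j _ => by ring
    have e2 : ∑ j, 2 * g j * ε j ω = 2 * (g ⬝ᵥ fun i => ε i ω) := by
      rw [dotProduct, Finset.mul_sum]
      exact Finset.sum_congr rfl fun j _ => by ring
    rw [e1, e2]
    ring
  have i1 : ∀ i j, Integrable (fun ω => G i j * (ε i ω * ε j ω)) P := fun i j =>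
    ((h.memLp i).integrable_mul (h.memLp j)).const_mul _
  have i2 : ∀ j, Integrable (fun ω => 2 * g j * ε j ω) P := fun j =>
    ((h.memLp j).integrable one_le_two).const_mul _
  have I1 : Integrable (fun ω => ∑ i, ∑ j, G i j * (ε i ω * ε j ω)) P :=
    integrable_finsetSum _ fun i _ => integrable_finsetSum _ fun j _ => i1 i j
  have I2 : Integrable (fun ω => ∑ j, 2 * g j * ε j ω) P :=
    integrable_finsetSum _ fun j _ => i2 j
  have I3 : Integrable (fun ω => ∑ i, ∑ j, G i j * (ε i ω * ε j ω) - ∑ j, 2 * g j * ε j ω) P :=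
    I1.sub I2
  simp only [e]
  refine ⟨I3.add (integrable_const _), ?_⟩
  rw [integral_add I3 (integrable_const _), integral_sub I1 I2,
    integral_finsetSum _ fun i _ => integrable_finsetSum _ fun j _ => i1 i j,
    integral_finsetSum _ fun j _ => i2 j, ← hG]
  have s1 : ∑ i, ∫ ω, ∑ j, G i j * (ε i ω * ε j ω) ∂P = σ ^ 2 * G.trace := by
    rw [Matrix.trace, Finset.mul_sum]
    refine Finset.sum_congr rfl fun i _ => ?_
    rw [integral_finsetSum _ fun j _ => i1 i j]
    simp only [integral_const_mul, h.integral_mul]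
    simp [mul_comm]
  have s2 : ∑ j, ∫ ω, 2 * g j * ε j ω ∂P = 0 := by
    simp only [integral_const_mul, h.integral_eq_zero, mul_zero, Finset.sum_const_zero]
  rw [s1, s2, integral_const, probReal_univ, one_smul]
  ring

lemma IsWhiteNoise.expectedRisk_eq [IsProbabilityMeasure P] (h : IsWhiteNoise P σ ε)
    {𝓧 : Type*} (x : Fin n → 𝓧) (fstar f : 𝓧 → ℝ) :
    expectedRisk P x (output fstar x ε) f =
      (1 / n) * (((fun i => f (x i)) - fun i => fstar (x i)) ⬝ᵥ
        ((fun i => f (x i)) - fun i => fstar (x i)) + σ ^ 2 * n) := by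
  have h1 := (h.integral_norm_sq 1 ((fun i => f (x i)) - fun i => fstar (x i))).2
  rw [transpose_one, mul_one, trace_one, Fintype.card_fin] at h1
  rw [← h1, expectedRisk, integral_const_mul]
  congr 2
  ext ω
  refine Finset.sum_congr rfl fun i _ => ?_
  simp only [output, one_mulVec, Pi.sub_apply]
  ring

end Noise

/-! ### Excess risk in a reproducing kernel Hilbert space -/

section RKHS

variable {𝓧 : Type*} {H : Type*} [NormedAddCommGroup H] [InnerProductSpace ℝ H] [CompleteSpace H]
  [RKHS ℝ H 𝓧 ℝ] {k : 𝓧 → 𝓧 → ℝ} {n : ℕ}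

/-- The function `∑ j, a j k(·, x j)` as an element of the reproducing kernel Hilbert space. -/
noncomputable def kernelSum (H : Type*) [NormedAddCommGroup H] [InnerProductSpace ℝ H]
    [CompleteSpace H] [RKHS ℝ H 𝓧 ℝ] (x : Fin n → 𝓧) (a : Fin n → ℝ) : H :=
  ∑ j, a j • RKHS.kerFun H (x j) 1

lemma inner_kernelSum (x : Fin n → 𝓧) (a : Fin n → ℝ) (f : H) :
    inner ℝ (kernelSum H x a) f = ∑ j, a j * f (x j) := by
  rw [kernelSum, sum_inner]
  refine Finset.sum_congr rfl fun j _ => ?_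
  rw [real_inner_smul_left, RKHS.kerFun_inner]
  simp

lemma kernelSum_apply (hk : IsKernelOf k H) (x : Fin n → 𝓧) (a : Fin n → ℝ) (i : Fin n) :
    kernelSum H x a (x i) = (gram k x *ᵥ a) i := by
  have h : (kernelSum H x a : 𝓧 → ℝ) = ∑ j, a j • ⇑(RKHS.kerFun H (x j) (1 : ℝ)) := by
    rw [kernelSum, ← RKHS.coeCLM_apply, map_sum]
    simp
  rw [h, Finset.sum_apply]
  simp only [mulVec, dotProduct, gram, Matrix.of_apply]
  refine Finset.sum_congr rfl fun j _ => ?_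
  rw [Pi.smul_apply, RKHS.kerFun_apply, hk, smul_eq_mul, mul_comm]

lemma IsKernelOf.symm (hk : IsKernelOf k H) (u v : 𝓧) : k u v = k v u := by
  have h : ∀ u v, k u v = inner ℝ (RKHS.kerFun H v (1 : ℝ)) (RKHS.kerFun H u (1 : ℝ)) :=
    fun u v => by
      rw [← RKHS.kernel_inner, hk]
      simp
  rw [h, h, real_inner_comm]

lemma norm_kernelSum_sq (hk : IsKernelOf k H) (x : Fin n → 𝓧) (a : Fin n → ℝ) :
    ‖kernelSum H x a‖ ^ 2 = a ⬝ᵥ gram k x *ᵥ a := by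
  rw [← real_inner_self_eq_norm_sq, inner_kernelSum]
  simp only [kernelSum_apply hk]
  rfl

lemma gram_posSemidef (hk : IsKernelOf k H) (x : Fin n → 𝓧) : (gram k x).PosSemidef := by
  refine posSemidef_of_form_nonneg ?_ fun u => ?_
  · ext i j
    exact hk.symm _ _
  · rw [← norm_kernelSum_sq (H := H) hk]
    positivity

/-- Vectors in the kernel of the Gram matrix are orthogonal to the values at the design points of
all functions of the Hilbert space. -/
lemma dotProduct_apply_eq_zero (hk : IsKernelOf k H) (x : Fin n → 𝓧) {w : Fin n → ℝ}
    (hw : gram k x *ᵥ w = 0) (f : H) : w ⬝ᵥ (fun i => f (x i)) = 0 := by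
  have h : kernelSum H x w = 0 := by
    rw [← norm_eq_zero, ← sq_eq_zero_iff, norm_kernelSum_sq hk, hw, dotProduct_zero]
  have := inner_kernelSum x w f
  rw [h, inner_zero_left] at this
  exact this.symm

lemma dotProduct_sub_sub_self_of_orthogonal {a b w : Fin n → ℝ} (ha : w ⬝ᵥ a = 0)
    (hb : w ⬝ᵥ b = 0) :
    (a - (b + w)) ⬝ᵥ (a - (b + w)) = (a - b) ⬝ᵥ (a - b) + w ⬝ᵥ w := by
  simp only [dotProduct_sub, sub_dotProduct, dotProduct_add, add_dotProduct, dotProduct_comm a w,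
    dotProduct_comm b w, ha, hb]
  ring

variable {Ω : Type*} [MeasurableSpace Ω] {P : Measure Ω} [IsProbabilityMeasure P] {σ : ℝ}
  {ε : Fin n → Ω → ℝ}

/-- The excess risk of a function in the span of the kernel sections is the squared distance to the
projection `K a₀` of the target values onto the range of the Gram matrix `K`. -/
lemma excessRisk_eq (hk : IsKernelOf k H) (h : IsWhiteNoise P σ ε) (x : Fin n → 𝓧)
    (fstar : 𝓧 → ℝ) {a₀ w : Fin n → ℝ} (hw : gram k x *ᵥ w = 0)
    (hstar : (fun i => fstar (x i)) = gram k x *ᵥ a₀ + w) (f : 𝓧 → ℝ) {a : Fin n → ℝ}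
    (hf : (fun i => f (x i)) = gram k x *ᵥ a) :
    excessRisk H P x (output fstar x ε) f =
      (1 / n) * ((gram k x *ᵥ a - gram k x *ᵥ a₀) ⬝ᵥ (gram k x *ᵥ a - gram k x *ᵥ a₀)) := by
  have hval : ∀ a, (fun i => kernelSum H x a (x i)) = gram k x *ᵥ a := fun a =>
    funext fun i => kernelSum_apply hk x a i
  have horth : ∀ a, w ⬝ᵥ gram k x *ᵥ a = 0 := fun a => by
    rw [← hval]; exact dotProduct_apply_eq_zero hk x hw _
  have hinf : ⨅ v : H, expectedRisk P x (output fstar x ε) (⇑v) =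
      (1 / n) * (w ⬝ᵥ w + σ ^ 2 * n) := by
    refine IsLeast.csInf_eq ⟨⟨kernelSum H x a₀, ?_⟩, ?_⟩
    · beta_reduce
      rw [h.expectedRisk_eq, hval, hstar,
        dotProduct_sub_sub_self_of_orthogonal (horth a₀) (horth a₀), sub_self, dotProduct_zero,
        zero_add]
    · rintro _ ⟨v, rfl⟩
      beta_reduce
      rw [h.expectedRisk_eq, hstar, dotProduct_sub_sub_self_of_orthogonal
        (dotProduct_apply_eq_zero hk x hw v) (horth a₀)]
      refine mul_le_mul_of_nonneg_left ?_ (by positivity)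
      have : ∀ z : Fin n → ℝ, 0 ≤ z ⬝ᵥ z := fun z =>
        Finset.sum_nonneg fun i _ => mul_self_nonneg _
      linarith [this ((fun i => v (x i)) - gram k x *ᵥ a₀)]
  rw [excessRisk, hinf, h.expectedRisk_eq, hf, hstar,
    dotProduct_sub_sub_self_of_orthogonal (horth a) (horth a₀)]
  ring

end RKHS

/-! ### Fitted values of the two estimators -/

section Estimators

variable {n : ℕ}

lemma exists_range_add_ker {K : Matrix (Fin n) (Fin n) ℝ} (hK : Kᵀ = K) (μ : Fin n → ℝ) :
    ∃ a w, μ = K *ᵥ a + w ∧ K *ᵥ w = 0 := by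
  obtain ⟨U, f, hU, hU', rfl⟩ := exists_eq_spectralMatrix hK
  -- the convention `0⁻¹ = 0` makes this the pseudoinverse
  refine ⟨spectralMatrix U (fun i => (f i)⁻¹) *ᵥ μ,
    μ - spectralMatrix U f *ᵥ (spectralMatrix U (fun i => (f i)⁻¹) *ᵥ μ), by abel, ?_⟩
  rw [mulVec_sub, mulVec_mulVec, mulVec_mulVec, spectralMatrix_mul hU,
    spectralMatrix_mul hU, ← sub_mulVec, spectralMatrix_sub]
  have : (fun i => f i - f i * f i * (f i)⁻¹) = 0 := by
    ext i
    by_cases h : f i = 0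
    · simp [h]
    · rw [Pi.zero_apply, mul_assoc, mul_inv_cancel₀ h, mul_one, sub_self]
  rw [this]
  have h0 : spectralMatrix U (0 : Fin n → ℝ) = 0 := by
    simp [spectralMatrix]
  rw [h0, zero_mulVec]

variable {𝓧 : Type*} {k : 𝓧 → 𝓧 → ℝ} {x : Fin n → 𝓧}

lemma krls_apply (lam : ℝ) (y : Fin n → ℝ) :
    (fun i => krls k x lam y (x i)) =
      gram k x *ᵥ ((gram k x + (lam * n) • (1 : Matrix (Fin n) (Fin n) ℝ))⁻¹ *ᵥ y) := by
  ext i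
  exact Finset.sum_congr rfl fun j _ => mul_comm _ _

lemma gramNM_eq (M : Finset (Fin n)) : gramNM k x M = gram k x * selection M := by
  rw [mul_selection]; rfl

lemma gramMM_eq (M : Finset (Fin n)) :
    gramMM k x M = (selection M)ᵀ * gram k x * selection M := by
  rw [Matrix.mul_assoc, mul_selection]
  ext i j
  have := selection_transpose_mulVec M (fun l => gram k x l j) i
  exact this.symm

lemma nytro_apply (hsymm : ∀ u v, k u v = k v u) (M : Finset (Fin n)) {r : ℕ}
    (R : Matrix M (Fin r) ℝ) (γ : ℝ) (t : ℕ) (y : Fin n → ℝ) :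
    (fun i => nytro k x M R γ t y (x i)) =
      gram k x *ᵥ (selection M *ᵥ (R *ᵥ nytroIter k x M R γ y t)) := by
  rw [mulVec_mulVec, ← gramNM_eq]
  ext i
  refine Finset.sum_congr rfl fun j _ => ?_
  rw [mul_comm, hsymm]
  rfl

/-- The fitted values of gradient descent, in closed form. -/
lemma gramNM_mulVec_nytroIter (hK : (gram k x)ᵀ = gram k x) (M : Finset (Fin n)) {r : ℕ}
    (R : Matrix M (Fin r) ℝ) (γ : ℝ) (y : Fin n → ℝ) (t : ℕ) :
    gram k x *ᵥ (selection M *ᵥ (R *ᵥ nytroIter k x M R γ y t)) =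
      (1 - (1 - (γ / n) • nystrom (gram k x) M (R * Rᵀ)) ^ t) *ᵥ y := by
  induction t with
  | zero => simp [nytroIter]
  | succ t ih =>
    set K := gram k x
    set B := (γ / n) • nystrom K M (R * Rᵀ) with hB
    have e : K *ᵥ (selection M *ᵥ (R *ᵥ ((γ / n) • Rᵀ *ᵥ ((gramNM k x M)ᵀ *ᵥ
        (gramNM k x M *ᵥ (R *ᵥ nytroIter k x M R γ y t) - y))))) =
        B *ᵥ (gramNM k x M *ᵥ (R *ᵥ nytroIter k x M R γ y t) - y) := by
      rw [gramNM_eq, transpose_mul, hK, hB, nystrom, smul_mulVec, mulVec_smul, mulVec_smul,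
        mulVec_smul]
      congr 1
      simp only [mulVec_mulVec, Matrix.mul_assoc]
    rw [nytroIter, mulVec_sub, mulVec_sub, mulVec_sub, e, gramNM_eq, ← mulVec_mulVec, ih,
      pow_succ']
    simp only [sub_mulVec, one_mulVec, mulVec_sub, mulVec_mulVec, sub_mul, one_mul]
    abel

end Estimators

/-! ### Expected excess risk of linear estimators -/

section ExpectedExcessRisk

variable {𝓧 : Type*} {H : Type*} [NormedAddCommGroup H] [InnerProductSpace ℝ H] [CompleteSpace H]
  [RKHS ℝ H 𝓧 ℝ] {k : 𝓧 → 𝓧 → ℝ} {n : ℕ} {Ω : Type*} [MeasurableSpace Ω] {P : Measure Ω}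
  [IsProbabilityMeasure P] {σ : ℝ} {ε : Fin n → Ω → ℝ}

/-- The expected excess risk of a linear estimator: if the fitted values `T y` lie in the range of
the Gram matrix `K` and `T` vanishes on the component `w` of the target that is orthogonal to it,
the bias is that of the projected target `K a₀`. -/
lemma integral_excessRisk_linear (hk : IsKernelOf k H) (h : IsWhiteNoise P σ ε) (x : Fin n → 𝓧)
    (fstar : 𝓧 → ℝ) {a₀ w : Fin n → ℝ} (hw : gram k x *ᵥ w = 0)
    (hstar : (fun i => fstar (x i)) = gram k x *ᵥ a₀ + w) (T : Matrix (Fin n) (Fin n) ℝ)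
    (hTw : T *ᵥ w = 0) (F : (Fin n → ℝ) → 𝓧 → ℝ) (a : (Fin n → ℝ) → Fin n → ℝ)
    (hF : ∀ y, (fun i => F y (x i)) = gram k x *ᵥ a y) (hT : ∀ y, gram k x *ᵥ a y = T *ᵥ y) :
    Integrable (fun ω => excessRisk H P x (output fstar x ε) (F (output fstar x ε ω))) P ∧
    ∫ ω, excessRisk H P x (output fstar x ε) (F (output fstar x ε ω)) ∂P =
      (1 / n) * (((1 - T) *ᵥ (gram k x *ᵥ a₀)) ⬝ᵥ ((1 - T) *ᵥ (gram k x *ᵥ a₀)) +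
        σ ^ 2 * (Tᵀ * T).trace) := by
  have e : ∀ ω, excessRisk H P x (output fstar x ε) (F (output fstar x ε ω)) =
      (1 / n) * ((T *ᵥ (fun i => ε i ω) - (1 - T) *ᵥ (gram k x *ᵥ a₀)) ⬝ᵥ
        (T *ᵥ (fun i => ε i ω) - (1 - T) *ᵥ (gram k x *ᵥ a₀))) := by
    intro ω
    have hout : output fstar x ε ω = gram k x *ᵥ a₀ + w + fun i => ε i ω := by
      rw [← hstar]; rfl
    have hdiff : T *ᵥ output fstar x ε ω - gram k x *ᵥ a₀ =
        T *ᵥ (fun i => ε i ω) - (1 - T) *ᵥ (gram k x *ᵥ a₀) := by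
      rw [hout, mulVec_add, mulVec_add, hTw, sub_mulVec, one_mulVec]
      abel
    rw [excessRisk_eq hk h x fstar hw hstar _ (hF _), hT, hdiff]
  have hint := h.integral_norm_sq T ((1 - T) *ᵥ (gram k x *ᵥ a₀))
  simp only [e]
  exact ⟨hint.1.const_mul _, by rw [integral_const_mul, hint.2]⟩

end ExpectedExcessRisk

/-! ### Comparison of the Nyström matrix with the kernel matrix -/

section Factors

variable {n : ℕ} {K : Matrix (Fin n) (Fin n) ℝ}

lemma nystrom_mul_transpose_posSemidef (hK : Kᵀ = K) (M : Finset (Fin n)) {r : ℕ}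
    (R : Matrix M (Fin r) ℝ) : (nystrom K M (R * Rᵀ)).PosSemidef := by
  have h := posSemidef_self_mul_conjTranspose (K * selection M * R)
  rw [conjTranspose_eq_transpose_of_trivial, transpose_mul, transpose_mul, hK] at h
  rw [nystrom]
  convert h using 1
  simp only [Matrix.mul_assoc]

lemma sub_nystrom_posSemidef (hK : K.PosSemidef) {M : Finset (Fin n)} {Q : Matrix M M ℝ}
    (hQ : IsPseudoinverse ((selection M)ᵀ * K * selection M) Q) (hQs : Qᵀ = Q) :
    (K - nystrom K M Q).PosSemidef := by
  obtain ⟨U, f, hU, hU', rfl⟩ := exists_eq_spectralMatrix (isSymm_of_posSemidef hK)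
  have hf := eigenvalue_nonneg_of_form_nonneg hU (form_nonneg_of_posSemidef hK)
  refine nystrom_residual_posSemidef (C := spectralMatrix U fun i => √(f i))
    (spectralMatrix_transpose _) ?_ (selection M) hQ hQs
  rw [spectralMatrix_mul hU]
  congr 1
  ext i
  exact Real.mul_self_sqrt (hf i)

lemma nystrom_mulVec_eq_zero (M : Finset (Fin n)) (Q : Matrix M M ℝ) {w : Fin n → ℝ}
    (hw : K *ᵥ w = 0) : nystrom K M Q *ᵥ w = 0 := by
  rw [nystrom, ← mulVec_mulVec, ← mulVec_mulVec w, hw, mulVec_zero, mulVec_zero]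

lemma one_sub_pow_mulVec_eq_self {B : Matrix (Fin n) (Fin n) ℝ} {w : Fin n → ℝ}
    (hw : B *ᵥ w = 0) (t : ℕ) : (1 - B) ^ t *ᵥ w = w := by
  induction t with
  | zero => rw [pow_zero, one_mulVec]
  | succ t ih => rw [pow_succ', ← mulVec_mulVec, ih, sub_mulVec, hw, one_mulVec, sub_zero]

end Factors

end Nytro

/-! ### Comparison of NYTRO and KRLS -/

open Nytro Matrix in
theorem corollary1
    -- input space `ℝ^d`, and the RKHS `H` with kernel `k`
    {d : ℕ} {H : Type*} [NormedAddCommGroup H] [InnerProductSpace ℝ H] [CompleteSpace H]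
    [RKHS ℝ H (EuclideanSpace ℝ (Fin d)) ℝ]
    (k : EuclideanSpace ℝ (Fin d) → EuclideanSpace ℝ (Fin d) → ℝ)
    (hk : Nytro.IsKernelOf k H)
    -- fixed design points, target function, i.i.d. centred noise with variance `σ²`
    {n : ℕ} (x : Fin n → EuclideanSpace ℝ (Fin d)) (fstar : EuclideanSpace ℝ (Fin d) → ℝ)
    {Ω : Type*} [MeasurableSpace Ω] (P : Measure Ω) [IsProbabilityMeasure P]
    (ρ : Measure ℝ) [IsProbabilityMeasure ρ] (σ : ℝ)
    (hρ2 : MemLp id 2 ρ) (hρmean : ∫ s, s ∂ρ = 0) (hρvar : variance id ρ = σ ^ 2)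
    (ε : Fin n → Ω → ℝ) (hlaw : ∀ i, HasLaw (ε i) ρ P) (hindep : iIndepFun ε P)
    -- parameters
    (hK : Nytro.gram k x ≠ 0)
    (γ : ℝ) (hγ : γ = 1 / Nytro.specNorm (Nytro.gram k x))
    (t : ℕ) (ht : 2 ≤ t) (δ : ℝ) (hδ0 : 0 < δ) (hδ1 : δ < 1)
    (m : ℕ) (hmn : m ≤ n)
    (hm : (32 * Nytro.dTilde (Nytro.gram k x) (1 / (γ * t)) / δ + 2) *
        Real.log (n * Nytro.specNorm (Nytro.gram k x) * γ * t / δ) ≤ (m : ℝ))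
    -- for every subset `M`, a factor `R` with `R Rᵀ = K_mm^†` and `rank K_mm` columns
    (R : ∀ M : Finset (Fin n), Matrix M (Fin (Nytro.gramMM k x M).rank) ℝ)
    (hR : ∀ M, Nytro.IsPseudoinverse (Nytro.gramMM k x M) (R M * (R M).transpose)) :
    (∀ M ∈ Finset.powersetCard m (Finset.univ : Finset (Fin n)),
      Integrable (fun ω => Nytro.excessRisk H P x (Nytro.output fstar x ε)
        (Nytro.nytro k x M (R M) γ t (Nytro.output fstar x ε ω))) P) ∧
    Integrable (fun ω => Nytro.excessRisk H P x (Nytro.output fstar x ε)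
        (Nytro.krls k x (1 / (γ * t)) (Nytro.output fstar x ε ω))) P ∧
    (𝔼 M ∈ Finset.powersetCard m (Finset.univ : Finset (Fin n)),
        ∫ ω, Nytro.excessRisk H P x (Nytro.output fstar x ε)
          (Nytro.nytro k x M (R M) γ t (Nytro.output fstar x ε ω)) ∂P) ≤
      (4 * (1 + 1 / ((t : ℝ) - 1)) ^ 2 * (1 + 4 * δ)) *
        ∫ ω, Nytro.excessRisk H P x (Nytro.output fstar x ε)
          (Nytro.krls k x (1 / (γ * t)) (Nytro.output fstar x ε ω)) ∂P ∧
    4 * (1 + 1 / ((t : ℝ) - 1)) ^ 2 * (1 + 4 * δ) ≤ 80 := by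
  have hnoise : IsWhiteNoise P σ ε := isWhiteNoise_of_iid hρ2 hρmean hρvar hlaw hindep
  set K := gram k x with hKdef
  have hKpsd : K.PosSemidef := gram_posSemidef (H := H) hk x
  have hKs : Kᵀ = K := isSymm_of_posSemidef hKpsd
  have hn : 0 < n := by
    rcases Nat.eq_zero_or_pos n with rfl | h
    · exact absurd (Subsingleton.elim _ _) hK
    · exact h
  have hn0 : (0 : ℝ) < n := by exact_mod_cast hn
  have ht0 : (0 : ℝ) < t := by positivity
  have hκ0 : 0 < specNorm K := specNorm_pos hK
  set κ := specNorm K with hκ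
  set lam : ℝ := 1 / (γ * t) with hlamdef
  have hlam : t * (lam * n) = n * κ := by
    rw [hlamdef, hγ]
    field_simp
  have hstep : γ / n = 1 / (t * (lam * n)) := by
    rw [hlam, hγ]
    field_simp
  have hc0 : 0 < lam * n := by
    rw [hlamdef, hγ]
    positivity
  have hlog : n * κ * γ * t / δ = n * t / δ := by
    rw [hγ]
    field_simp
  rw [hlog] at hm
  obtain ⟨a₀, w, hstar, hw⟩ := exists_range_add_ker hKs fun i => fstar (x i)
  set v := K *ᵥ a₀ with hv
  -- KRLS as a linear estimator
  set S := K * (K + (lam * n) • (1 : Matrix (Fin n) (Fin n) ℝ))⁻¹ with hS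
  have hinv := (add_smul_one_mul_inv hKpsd hc0).1
  have hScomm : S = (K + (lam * n) • (1 : Matrix (Fin n) (Fin n) ℝ))⁻¹ * K :=
    mul_add_smul_one_inv_comm hKpsd hc0
  have hSw : S *ᵥ w = 0 := by rw [hScomm, ← mulVec_mulVec, hw, mulVec_zero]
  have hSs : Sᵀ = S := isSymm_of_posSemidef (tikhonov_posSemidef hKpsd hc0)
  obtain ⟨hkrlsInt, hkrls⟩ := integral_excessRisk_linear hk hnoise x fstar hw hstar S hSw
    (krls k x lam) _ (krls_apply lam) fun y => mulVec_mulVec _ _ _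
  rw [hSs] at hkrls
  -- NYTRO as a linear estimator, for each subset
  set Q : ∀ M : Finset (Fin n), Matrix M M ℝ := fun M => R M * (R M)ᵀ with hQdef
  have hQ : ∀ M, IsPseudoinverse ((selection M)ᵀ * K * selection M) (Q M) := fun M => by
    rw [← gramMM_eq]; exact hR M
  have hQs : ∀ M, (Q M)ᵀ = Q M := fun M => by rw [hQdef, transpose_mul, transpose_transpose]
  have hL : ∀ M, (nystrom K M (Q M)).PosSemidef := fun M =>
    nystrom_mul_transpose_posSemidef hKs M (R M)
  have hKL : ∀ M, (K - nystrom K M (Q M)).PosSemidef := fun M =>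
    sub_nystrom_posSemidef hKpsd (hQ M) (hQs M)
  set B : Finset (Fin n) → Matrix (Fin n) (Fin n) ℝ :=
    fun M => (1 / (t * (lam * n))) • nystrom K M (Q M) with hB
  have hBs : ∀ M, (B M)ᵀ = B M := fun M => by
    rw [hB, transpose_smul, isSymm_of_posSemidef (hL M)]
  have hBw : ∀ M, B M *ᵥ w = 0 := fun M => by
    rw [hB, smul_mulVec, nystrom_mulVec_eq_zero M _ hw, smul_zero]
  have hnytro : ∀ M, Integrable (fun ω => excessRisk H P x (output fstar x ε)
        (nytro k x M (R M) γ t (output fstar x ε ω))) P ∧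
      ∫ ω, excessRisk H P x (output fstar x ε)
        (nytro k x M (R M) γ t (output fstar x ε ω)) ∂P =
      (1 / n) * (((1 - B M) ^ t *ᵥ v) ⬝ᵥ ((1 - B M) ^ t *ᵥ v) +
        σ ^ 2 * ((1 - (1 - B M) ^ t) * (1 - (1 - B M) ^ t)).trace) := by
    intro M
    have h := integral_excessRisk_linear hk hnoise x fstar hw hstar (1 - (1 - B M) ^ t)
      (by rw [sub_mulVec, one_mulVec, one_sub_pow_mulVec_eq_self (hBw M), sub_self])
      (nytro k x M (R M) γ t) _ (nytro_apply hk.symm M (R M) γ t)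
      (fun y => by rw [gramNM_mulVec_nytroIter hKs, hstep])
    rwa [sub_sub_cancel, transpose_sub, transpose_pow, transpose_sub, transpose_one, hBs] at h
  refine ⟨fun M _ => (hnytro M).1, hkrlsInt, ?_, ?_⟩
  · set A := powersetCard m (univ : Finset (Fin n)) with hA
    have hA0 : (0 : ℝ) < A.card := by
      rw [hA, card_powersetCard, card_univ, Fintype.card_fin]
      exact_mod_cast Nat.choose_pos hmn
    have hqv : (lam * n) • v = (K + (lam * n) • 1) *ᵥ ((1 - S) *ᵥ v) := by
      have h1 : (K + (lam * n) • (1 : Matrix (Fin n) (Fin n) ℝ)) * (1 - S) = (lam * n) • 1 := by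
        rw [mul_sub, mul_one, hScomm, ← mul_assoc, hinv, one_mul, add_sub_cancel_left]
      rw [mulVec_mulVec, h1, smul_mulVec, one_mulVec]
    have hbias := sum_bias_le hn hKpsd hκ hκ0 (by omega) hlam hδ0 hδ1 hmn hm Q hQ hQs hL hKL
      ((1 - S) *ᵥ v) v hqv
    have hvar : ∀ M, ((1 - (1 - B M) ^ t) * (1 - (1 - B M) ^ t)).trace ≤ 4 * (S * S).trace :=
      fun M => landweber_variance_le hKpsd (hL M) (hKL M) hc0 (by omega) rfl
        (nystrom_step_form_le hn hKpsd hκ hκ0 hlam (hKL M))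
    rw [Finset.expect_eq_sum_div_card, div_le_iff₀ hA0, hkrls,
      Finset.sum_congr rfl fun M _ => (hnytro M).2, ← Finset.mul_sum, Finset.sum_add_distrib]
    set b := ((1 - S) *ᵥ v) ⬝ᵥ ((1 - S) *ᵥ v)
    set τ := (S * S).trace with hτ
    have hb0 : 0 ≤ b := Finset.sum_nonneg fun i _ => mul_self_nonneg _
    have hτ0 : 0 ≤ τ := by
      have := trace_mul_transpose_self_nonneg S
      rwa [hSs] at this
    have hvarsum : ∑ M ∈ A, σ ^ 2 * ((1 - (1 - B M) ^ t) * (1 - (1 - B M) ^ t)).trace ≤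
        A.card * (4 * (σ ^ 2 * τ)) := by
      rw [← nsmul_eq_mul]
      refine Finset.sum_le_card_nsmul _ _ _ fun M _ => ?_
      have := mul_le_mul_of_nonneg_left (hvar M) (sq_nonneg σ)
      linarith
    have hfac : 1 ≤ (1 + 1 / ((t : ℝ) - 1)) ^ 2 := by
      have ht2 : (2 : ℝ) ≤ t := by exact_mod_cast ht
      have : 0 ≤ 1 / ((t : ℝ) - 1) := by
        have : (0 : ℝ) < t - 1 := by linarith
        positivity
      nlinarith
    have hστ : 0 ≤ σ ^ 2 * τ := by positivity
    calc (1 / n : ℝ) * (∑ M ∈ A, ((1 - B M) ^ t *ᵥ v) ⬝ᵥ ((1 - B M) ^ t *ᵥ v) +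
          ∑ M ∈ A, σ ^ 2 * ((1 - (1 - B M) ^ t) * (1 - (1 - B M) ^ t)).trace)
        ≤ (1 / n : ℝ) * (A.card * (4 * (1 + 4 * δ) * b) + A.card * (4 * (σ ^ 2 * τ))) :=
          mul_le_mul_of_nonneg_left (add_le_add hbias hvarsum) (by positivity)
      _ ≤ (1 / n : ℝ) * (A.card * (4 * (1 + 4 * δ) * (b + σ ^ 2 * τ))) := by
          refine mul_le_mul_of_nonneg_left ?_ (by positivity)
          rw [← mul_add]
          refine mul_le_mul_of_nonneg_left ?_ hA0.le
          nlinarith [mul_nonneg hδ0.le hστ]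
      _ = 1 * ((1 / n : ℝ) * (A.card * (4 * (1 + 4 * δ) * (b + σ ^ 2 * τ)))) := (one_mul _).symm
      _ ≤ (1 + 1 / ((t : ℝ) - 1)) ^ 2 *
            ((1 / n : ℝ) * (A.card * (4 * (1 + 4 * δ) * (b + σ ^ 2 * τ)))) :=
          mul_le_mul_of_nonneg_right hfac (by positivity)
      _ = _ := by ring
  · have ht2 : (2 : ℝ) ≤ t := by exact_mod_cast ht
    have h1 : 1 / ((t : ℝ) - 1) ≤ 1 := by
      rw [div_le_one (by linarith)]; linarith
    have h0 : 0 ≤ 1 / ((t : ℝ) - 1) := div_nonneg zero_le_one (by linarith)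
    have h2 : (1 + 1 / ((t : ℝ) - 1)) ^ 2 ≤ 4 := by nlinarith
    nlinarith
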